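/- Setting. Let $[n]=\{1,\dots,n\}$ and let $E$ be a set of subsets (edges) of $[n]$. The $n$-qubit hypergraph state $\Psi=|\Psi\rangle\langle\Psi|$ with edge set $E$ is given by $|\Psi\rangle=\prod_{e\in E}\mathrm{C}^{|e|-1}Z_e\,|+\rangle^{\otimes n}$, where $\mathrm{C}^{|e|-1}Z_e$ is the diagonal gate that multiplies by $-1$ exactly the computational basis states having $1$ at every qubit of $e$ (for $e=\emptyset$ it is the global phase $-1$). A pure stabilizer state on $n$ qubits is a state whose unit vector is fixed by exactly $2^n$ elements of the Pauli group $\{i^kP_1\otimes\cdots\otimes P_n: 0\le k\le 3,\ P_j\in\{I,X,Y,Z\}\}$, and $\mathrm{STAB}_n$ is the convex hull of the pure stabilizer states. The robustness of magic (RoM) of an $n$-qubit state $\rho$ is $$\mathcal R(\rho)=\min\{2a+1:\ \rho=(a+1)\sigma-a\tau,\ a\ge 0,\ \sigma,\tau\in\mathrm{STAB}_n\}.$$ For a noise rate $0\le\lambda\le 1$, $\mathcal E_\lambda(\rho)=(1-\lambda)\rho+\lambda\operatorname{Tr}(\rho)\,\mathbb I_2/2$ is the single-qubit depolarizing channel,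 and $\mathcal E_\lambda^{\otimes n}$ acts independently on the $n$ qubits. For $I\subseteq[n]$ and $\mathbf s\in\{0,1\}^I$, the reduced hypergraph state $\Psi^{(I,\mathbf s)}$ is the hypergraph state on the qubits $[n]\setminus I$ obtained as follows: delete every edge that contains some $i\in I$ with $s_i=0$; replace every other edge $e$ by $e\setminus I$; keep exactly those resulting edges that occur with odd multiplicity. Put $$C_\Psi=\max_{I\subseteq[n],\ \mathbf s\in\{0,1\}^I}\mathcal R\big(\Psi^{(I,\mathbf s)}\big).$$ Theorem. Let $\Psi$ be the $n$-qubit hypergraph state with edge set $E$, let $e_1,\dots,e_K\subseteq[n]$, and let $\Phi$ be the hypergraph state with edge set $E\cup\{e_1,\dots,e_K\}$. Then for every $0\le\lambda\le1$ $$\mathcal R\big(\mathcal E_\lambda^{\otimes n}(\Phi)\big)\le\mathcal R\big(\mathcal E_\lambda^{\otimes n}(\Psi)\big)+C_\Psi\sum_{\emptyset\ne J\subseteq[K]}\big(5^{|J|}+1\big)\Big(1-\frac\lambda2\Big)^{\left|\bigcup_{j\in J}e_j\right|}.$$ Consequently, if $|e_j|\ge m$ for all $j\in[K]$, then $$\mathcal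 R\big(\mathcal E_\lambda^{\otimes n}(\Phi)\big)\le\mathcal R\big(\mathcal E_\lambda^{\otimes n}(\Psi)\big)+C_\Psi\,\big(6^K+2^K-2\big)\Big(1-\frac\lambda2\Big)^{m},$$ so that for fixed $K$ and $\lambda>0$ the contribution of the added edges, relative to $C_\Psi$, is exponentially small in $m$. -/

import Mathlib

namespace HypergraphMagic

open scoped BigOperators

/-! Qubits are labelled by a finite type `V`; computational basis states are bit strings
`x : V → Fin 2`, vectors are functions on bit strings, and operators are complex matrices
indexed by bit strings. An `n`-qubit system is the case `V = Fin n`. -/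

/-- Bit strings on the qubits `V`. -/
abbrev Bits (V : Type) : Type := V → Fin 2

/-- Operators on the qubits `V`. -/
abbrev Op (V : Type) : Type := Matrix (Bits V) (Bits V) ℂ

section Tensor

variable {V : Type} [Fintype V]

/-- The tensor product over all qubits `v` of the single-qubit operators `A v`. -/
def tensorOp (A : V → Matrix (Fin 2) (Fin 2) ℂ) : Op V :=
  fun x y => ∏ v, A v (x v) (y v)

/-- The projector `|ψ⟩⟨ψ|`. -/
def ketbra (ψ : Bits V → ℂ) : Op V :=
  Matrix.vecMulVec ψ (star ψ)

end Tensor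

/-! ### Pauli operators, stabilizer states and robustness of magic -/

/-- The single-qubit Pauli matrices `I, X, Y, Z`. -/
def pauliMatrix : Fin 4 → Matrix (Fin 2) (Fin 2) ℂ :=
  ![!![1, 0; 0, 1], !![0, 1; 1, 0], !![0, -Complex.I; Complex.I, 0], !![1, 0; 0, -1]]

section Stabilizer

variable {V : Type} [Fintype V]

/-- Membership in the Pauli group: a tensor product of Pauli matrices with a phase
`1, i, -1` or `-i`. -/
def IsPauli (P : Op V) : Prop :=
  ∃ (k : Fin 4) (p : V → Fin 4),
    P = (Complex.I ^ (k : ℕ)) • tensorOp (fun v => pauliMatrix (p v))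

/-- `ψ` is (the state vector of) a pure stabilizer state: a unit vector fixed by `2 ^ n`
elements of the Pauli group, where `n` is the number of qubits. -/
def IsPureStabilizer [DecidableEq V] (ψ : Bits V → ℂ) : Prop :=
  (∑ x, ‖ψ x‖ ^ 2 = 1) ∧
    {P : Op V | IsPauli P ∧ P.mulVec ψ = ψ}.ncard = 2 ^ Fintype.card V

/-- The set of all stabilizer states: the convex hull of the pure stabilizer states. -/
def STAB (V : Type) [Fintype V] [DecidableEq V] : Set (Op V) :=
  convexHull ℝ {ρ | ∃ ψ : Bits V → ℂ, IsPureStabilizer ψ ∧ ρ = ketbra ψ}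

/-- Robustness of magic: the least value of `2 * a + 1` over all decompositions
`ρ = (a + 1) σ - a τ` with stabilizer states `σ, τ` and `a ≥ 0`. -/
noncomputable def RoM [DecidableEq V] (ρ : Op V) : ℝ :=
  sInf {r : ℝ | ∃ a : ℝ, 0 ≤ a ∧ ∃ σ ∈ STAB V, ∃ τ ∈ STAB V,
    ρ = (a + 1) • σ - a • τ ∧ r = 2 * a + 1}

end Stabilizer

/-! ### Depolarizing noise -/

/-- The single-qubit depolarizing channel: the qubit is left unchanged with probability
`1 - lam` and replaced by the maximally mixed state with probability `lam`. -/
noncomputable def depolarize (lam : ℝ) (ρ : Matrix (Fin 2) (Fin 2) ℂ) :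
    Matrix (Fin 2) (Fin 2) ℂ :=
  (1 - lam) • ρ + lam • (ρ.trace • ((2 : ℂ)⁻¹ • (1 : Matrix (Fin 2) (Fin 2) ℂ)))

/-- The tensor power of the depolarizing channel, acting independently on every qubit: the
linear map that sends each matrix unit `|a⟩⟨b| = ⨂ v, |a v⟩⟨b v|` to the tensor product of
the images of the factors `|a v⟩⟨b v|`. -/
noncomputable def noise {V : Type} [Fintype V] [DecidableEq V] (lam : ℝ) (ρ : Op V) : Op V :=
  ∑ a : Bits V, ∑ b : Bits V,
    ρ a b • tensorOp (fun v => depolarize lam (Matrix.single (a v) (b v) 1))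

/-! ### Hypergraph states -/

section Hypergraph

variable {V : Type}

/-- The diagonal of the multi-controlled-`Z` gate on the qubits in `e`: it flips the sign of
the basis states that are `1` on all of `e`. For `e = ∅` this is the global phase `-1`. -/
def czDiag (e : Finset V) (x : Bits V) : ℂ :=
  if ∀ i ∈ e, x i = 1 then -1 else 1

variable [Fintype V]

/-- The uniform superposition `|+⟩ ⊗ ⋯ ⊗ |+⟩`. -/
noncomputable def plusKet (V : Type) [Fintype V] : Bits V → ℂ :=
  fun _ => (((Real.sqrt (2 ^ Fintype.card V))⁻¹ : ℝ) : ℂ)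

/-- The state vector obtained from `|+⟩ ⊗ ⋯ ⊗ |+⟩` by applying the (diagonal, hence commuting)
multi-controlled-`Z` gates of all edges `e ∈ E`. -/
noncomputable def hypergraphKet [DecidableEq V] (E : Finset (Finset V)) : Bits V → ℂ :=
  (Matrix.diagonal (∏ e ∈ E, czDiag e)).mulVec (plusKet V)

/-- The hypergraph state of the hypergraph with edge set `E`, as a density operator. -/
noncomputable def hypergraphState [DecidableEq V] (E : Finset (Finset V)) : Op V :=
  ketbra (hypergraphKet E)

/-- The edge set, on the qubits outside `I`, that remains when the qubits in `I` are labelled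
by the bits `s` and removed: an edge containing a qubit labelled `0` is deleted, every other
edge `e` becomes `e \ I`, and of the resulting edges those with odd multiplicity are kept. -/
def reducedEdges [DecidableEq V] (E : Finset (Finset V)) (I : Finset V) (s : I → Fin 2) :
    Finset (Finset {i : V // i ∉ I}) :=
  Finset.univ.filter fun F =>
    Odd (E.filter fun e =>
      (∀ i : I, (i : V) ∈ e → s i = 1) ∧ e.subtype (fun i => i ∉ I) = F).card

/-- The maximum of the robustness of magic of the reduced hypergraph states over all sets `I`
of removed qubits and all labels `s` of these qubits. -/
noncomputable def maxReducedRoM [DecidableEq V] (E : Finset (Finset V)) : ℝ :=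
  (Finset.univ : Finset (Σ I : Finset V, (I → Fin 2))).sup'
    ⟨⟨∅, fun _ => 0⟩, Finset.mem_univ _⟩
    fun p => RoM (hypergraphState (reducedEdges E p.1 p.2))

end Hypergraph

end HypergraphMagic

open HypergraphMagic

/-!
Robustness is handled through `HasRobustness ρ r`, which says that `ρ` is a difference of two
nonnegative multiples of stabilizer states of total weight at most `r`. This makes sense for
operators of any trace, is subadditive, and for trace one bounds `RoM ρ` by `r`.

*Stabilizer states.* By Parseval's identity in the Pauli basis, a unit vector is a stabilizer state
exactly if all its Pauli expectation values are `0`, `1` or `-1` (`isPureStabilizer_iff`). This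
criterion shows that Pauli measurements (`IsPureStabilizer.add_pauliString_mulVec`) and tensor
products with basis states (`IsPureStabilizer.basisTensor`) preserve stabilizer states.

*One gate costs a factor five.* A multi-controlled-`Z` gate is `1 - 2 P`, where the projector `P` is
the average of the Pauli operators generated by the `-Z_i`. Expanding
`(1 - 2 P) |ψ⟩⟨ψ| (1 - 2 P)` for a stabilizer state `ψ` into post-measurement states of these
operators gives total weight at most `5` (`IsPureStabilizer.hasRobustness_conjDiag_czSign`).

*Noise as random measurement.* Depolarizing a set `I` of qubits replaces them by maximally mixed
ones, which is the same as measuring them first and forgetting the outcome `s`. A hypergraph state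
yields each outcome with equal probability and leaves its reduced hypergraph state. Hence the noisy
state is the mixture over `(I, s)`, with weights `(1 - λ) ^ |Iᶜ| (λ / 2) ^ |I|`, of the reduced
states padded with maximally mixed qubits (`noise_hypergraphState`).

*Comparison.* An added edge disappears from the reduced state as soon as one of its qubits is
measured with outcome `0`. If exactly the added edges in `J` survive, the reduced states of the two
hypergraphs differ by gates for the edges in `J`, so that their difference has robustness at most
`(5 ^ |J| + 1) C`, and it vanishes for `J = ∅`. All edges in `J` survive with probability
`(1 - λ / 2) ^ |⋃ J|` (`sum_weight_eq`). Summing over `J` gives the bound.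
-/

namespace HypergraphMagic

open scoped BigOperators
open Matrix

/-! ### Tensor products of single-qubit operators -/

section Tensor
variable {V : Type} [Fintype V]

lemma tensorOp_mul [DecidableEq V] (A B : V → Matrix (Fin 2) (Fin 2) ℂ) :
    tensorOp A * tensorOp B = tensorOp (fun v => A v * B v) := by
  ext x y
  simp only [Matrix.mul_apply, tensorOp, Finset.prod_univ_sum, Fintype.piFinset_univ,
    Finset.prod_mul_distrib]

lemma tensorOp_smul (c : V → ℂ) (A : V → Matrix (Fin 2) (Fin 2) ℂ) :
    tensorOp (fun v => c v • A v) = (∏ v, c v) • tensorOp A := by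
  ext x y
  simp [tensorOp, Finset.prod_mul_distrib]

lemma tensorOp_one [DecidableEq V] :
    tensorOp (fun _ : V => (1 : Matrix (Fin 2) (Fin 2) ℂ)) = 1 := by
  ext x y
  simp only [tensorOp, Matrix.one_apply, Finset.prod_ite_zero, Finset.prod_const_one,
    Finset.mem_univ, forall_true_left, funext_iff]

lemma tensorOp_conjTranspose (A : V → Matrix (Fin 2) (Fin 2) ℂ) :
    (tensorOp A).conjTranspose = tensorOp (fun v => (A v).conjTranspose) := by
  ext x y
  simp [tensorOp, Matrix.conjTranspose_apply]

lemma trace_tensorOp [DecidableEq V] (A : V → Matrix (Fin 2) (Fin 2) ℂ) :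
    (tensorOp A).trace = ∏ v, (A v).trace := by
  simp only [Matrix.trace, Matrix.diag, tensorOp, Finset.prod_univ_sum, Fintype.piFinset_univ]

end Tensor

/-! ### Pauli strings -/

lemma pauliMatrix_isHermitian (p : Fin 4) :
    (pauliMatrix p).conjTranspose = pauliMatrix p := by
  fin_cases p <;> ext i j <;> fin_cases i <;> fin_cases j <;> simp [pauliMatrix]

lemma pauliMatrix_sq (p : Fin 4) : pauliMatrix p * pauliMatrix p = 1 := by
  fin_cases p <;> ext i j <;> fin_cases i <;> fin_cases j <;>
    simp [pauliMatrix, Matrix.mul_apply, Fin.sum_univ_two]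

/-- The product of two Pauli matrices is a Pauli matrix up to a phase: the index is the
exclusive or of the indices in the labelling `I, X, Y, Z = 0, 1, 2, 3`. -/
lemma pauliMatrix_mul (p q : Fin 4) :
    ∃ (r : Fin 4) (c : ℂ), ‖c‖ = 1 ∧ pauliMatrix p * pauliMatrix q = c • pauliMatrix r := by
  refine ⟨(![![0, 1, 2, 3], ![1, 0, 3, 2], ![2, 3, 0, 1], ![3, 2, 1, 0]] :
      Fin 4 → Fin 4 → Fin 4) p q,
    (![![1, 1, 1, 1], ![1, 1, Complex.I, -Complex.I], ![1, -Complex.I, 1, Complex.I],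
      ![1, Complex.I, -Complex.I, 1]] : Fin 4 → Fin 4 → ℂ) p q, ?_, ?_⟩
  · fin_cases p <;> fin_cases q <;> simp
  · fin_cases p <;> fin_cases q <;> ext i j <;> fin_cases i <;> fin_cases j <;>
      simp [pauliMatrix, Matrix.mul_apply, Fin.sum_univ_two]

lemma pauliMatrix_comm_or_anticomm (p q : Fin 4) :
    ∃ s : ℂ, (s = 1 ∨ s = -1) ∧
      pauliMatrix p * pauliMatrix q = s • (pauliMatrix q * pauliMatrix p) := by
  refine ⟨(![![1, 1, 1, 1], ![1, 1, -1, -1], ![1, -1, 1, -1], ![1, -1, -1, 1]] :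
    Fin 4 → Fin 4 → ℂ) p q, ?_, ?_⟩
  · fin_cases p <;> fin_cases q <;> simp
  · fin_cases p <;> fin_cases q <;> ext i j <;> fin_cases i <;> fin_cases j <;>
      simp [pauliMatrix, Matrix.mul_apply, Fin.sum_univ_two]

lemma trace_pauliMatrix_mul (p q : Fin 4) :
    (pauliMatrix p * pauliMatrix q).trace = if p = q then 2 else 0 := by
  fin_cases p <;> fin_cases q <;>
    simp [pauliMatrix, Matrix.trace, Fin.sum_univ_two] <;> norm_num

/-- Completeness of the Pauli matrices: up to normalization they are a unitary basis change of
the space of single-qubit operators. -/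
lemma sum_pauliMatrix_mul_conj (a b c d : Fin 2) :
    ∑ p, pauliMatrix p a b * star (pauliMatrix p c d) =
      if a = c then (if b = d then 2 else 0) else 0 := by
  fin_cases a <;> fin_cases b <;> fin_cases c <;> fin_cases d <;>
    simp [pauliMatrix, Fin.sum_univ_four] <;> norm_num

section Strings
variable {V : Type} [Fintype V]

/-- The Pauli string `⨂ v, pauliMatrix (p v)`, without phase. -/
def pauliString (p : V → Fin 4) : Op V := tensorOp fun v => pauliMatrix (p v)

lemma pauliString_conjTranspose (p : V → Fin 4) :
    (pauliString p).conjTranspose = pauliString p := by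
  simp only [pauliString, tensorOp_conjTranspose, pauliMatrix_isHermitian]

variable [DecidableEq V]

lemma pauliString_sq (p : V → Fin 4) : pauliString p * pauliString p = 1 := by
  simp only [pauliString, tensorOp_mul, pauliMatrix_sq, tensorOp_one]

lemma pauliString_mul (p q : V → Fin 4) :
    ∃ (r : V → Fin 4) (c : ℂ), ‖c‖ = 1 ∧ pauliString p * pauliString q = c • pauliString r := by
  choose r c hc h using fun v => pauliMatrix_mul (p v) (q v)
  refine ⟨r, ∏ v, c v, ?_, ?_⟩
  · rw [norm_prod]
    exact Finset.prod_eq_one fun v _ => hc v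
  · simp only [pauliString, tensorOp_mul, h, tensorOp_smul]

lemma pauliString_comm_or_anticomm (p q : V → Fin 4) :
    pauliString p * pauliString q = pauliString q * pauliString p ∨
      pauliString p * pauliString q = -(pauliString q * pauliString p) := by
  choose s hs h using fun v => pauliMatrix_comm_or_anticomm (p v) (q v)
  have key : pauliString p * pauliString q =
      (∏ v, s v) • (pauliString q * pauliString p) := by
    simp only [pauliString, tensorOp_mul]
    rw [← tensorOp_smul]
    exact congrArg tensorOp (funext h)
  have hsign : (∏ v, s v) = 1 ∨ (∏ v, s v) = -1 :=
    Finset.prod_induction s (fun z => z = 1 ∨ z = -1)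
      (by rintro a b (rfl | rfl) (rfl | rfl) <;> simp) (Or.inl rfl) (fun v _ => hs v)
  rcases hsign with h1 | h1 <;> rw [key, h1]
  · left; simp
  · right; simp

lemma trace_pauliString_mul (p q : V → Fin 4) :
    (pauliString p * pauliString q).trace = if p = q then (2 : ℂ) ^ Fintype.card V else 0 := by
  simp only [pauliString, tensorOp_mul, trace_tensorOp, trace_pauliMatrix_mul,
    Finset.prod_ite_zero, Finset.mem_univ, forall_true_left, funext_iff, Finset.prod_const,
    Finset.card_univ]

lemma sum_pauliString_mul_conj (a b c d : Bits V) :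
    ∑ p : V → Fin 4, pauliString p a b * star (pauliString p c d) =
      if a = c then (if b = d then (2 : ℂ) ^ Fintype.card V else 0) else 0 := by
  have h : ∀ p : V → Fin 4, pauliString p a b * star (pauliString p c d) =
      ∏ v, pauliMatrix (p v) (a v) (b v) * star (pauliMatrix (p v) (c v) (d v)) := by
    intro p
    simp [pauliString, tensorOp, Finset.prod_mul_distrib]
  have h2 := Finset.prod_univ_sum (fun _ : V => (Finset.univ : Finset (Fin 4)))
    (fun v j => pauliMatrix j (a v) (b v) * star (pauliMatrix j (c v) (d v)))
  rw [Fintype.piFinset_univ] at h2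
  simp only [h]
  rw [← h2]
  simp only [sum_pauliMatrix_mul_conj, Finset.prod_ite_zero, Finset.mem_univ, forall_true_left,
    funext_iff, Finset.prod_const, Finset.card_univ]

end Strings

/-! ### Pauli expectation values and the characterization of stabilizer states -/

section Expect
variable {V : Type} [Fintype V] [DecidableEq V]

/-- The expectation value `⟨ψ|M|ψ⟩`. -/
def expect (M : Op V) (ψ : Bits V → ℂ) : ℂ := star ψ ⬝ᵥ (M *ᵥ ψ)

lemma star_expect (M : Op V) (ψ : Bits V → ℂ) : star (expect M ψ) = expect Mᴴ ψ := by
  rw [expect, expect, star_dotProduct, star_star, star_mulVec, ← dotProduct_mulVec]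

lemma expect_mulVec (M A : Op V) (ψ : Bits V → ℂ) :
    expect M (A *ᵥ ψ) = expect (Aᴴ * M * A) ψ := by
  rw [expect, expect, star_mulVec, ← dotProduct_mulVec, mulVec_mulVec, mulVec_mulVec,
    Matrix.mul_assoc]

lemma expect_add (M N : Op V) (ψ : Bits V → ℂ) :
    expect (M + N) ψ = expect M ψ + expect N ψ := by
  simp [expect, add_mulVec]

lemma expect_smul (c : ℂ) (M : Op V) (ψ : Bits V → ℂ) :
    expect (c • M) ψ = c * expect M ψ := by
  simp [expect, smul_mulVec]

lemma expect_smul_vec (M : Op V) (c : ℂ) (ψ : Bits V → ℂ) :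
    expect M (c • ψ) = (star c * c) * expect M ψ := by
  simp [expect, mulVec_smul]; ring

lemma expect_one (ψ : Bits V → ℂ) : expect 1 ψ = ((∑ x, ‖ψ x‖ ^ 2 : ℝ) : ℂ) := by
  simp only [expect, one_mulVec, dotProduct, Pi.star_apply, Complex.ofReal_sum]
  refine Finset.sum_congr rfl fun x _ => ?_
  rw [Complex.star_def, Complex.conj_mul']
  simp

lemma expect_eq_ofReal {M : Op V} (hM : Mᴴ = M) (ψ : Bits V → ℂ) :
    expect M ψ = ((expect M ψ).re : ℂ) := by
  have h := star_expect M ψ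
  rw [hM] at h
  exact (Complex.conj_eq_iff_re.mp h).symm

/-- The squared distance between `M ψ` and `ε ψ`, for a Hermitian involution `M`, a sign `ε` and a
unit vector `ψ`, is affine in the expectation value of `M`. -/
lemma sum_norm_sq_mulVec_sub {M : Op V} (hM : Mᴴ = M) (hMM : M * M = 1) {ψ : Bits V → ℂ}
    (hψ : ∑ x, ‖ψ x‖ ^ 2 = 1) {ε : ℝ} (hε : ε * ε = 1) :
    ∑ x, ‖(M *ᵥ ψ - (ε : ℂ) • ψ) x‖ ^ 2 = 2 - 2 * ε * (expect M ψ).re := by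
  have e1 : M *ᵥ ψ - (ε : ℂ) • ψ = (M + (-(ε : ℂ)) • 1) *ᵥ ψ := by
    rw [add_mulVec, smul_mulVec, one_mulVec, neg_smul, sub_eq_add_neg]
  have hε' : (ε : ℂ) * ε = 1 := by exact_mod_cast hε
  have e2 : (M + (-(ε : ℂ)) • (1 : Op V))ᴴ * 1 * (M + (-(ε : ℂ)) • 1) =
      (2 : ℂ) • (1 : Op V) + (-2 * (ε : ℂ)) • M := by
    rw [conjTranspose_add, conjTranspose_smul, conjTranspose_one, hM]
    simp only [star_neg, Complex.star_def, Complex.conj_ofReal, Matrix.mul_one, Matrix.add_mul,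
      Matrix.mul_add, hMM, Matrix.smul_mul, Matrix.mul_smul, Matrix.one_mul]
    have h2 : (2 : ℂ) • (1 : Op V) = 1 + ((ε : ℂ) * ε) • 1 := by rw [hε']; module
    rw [h2]
    module
  have h : ((∑ x, ‖(M *ᵥ ψ - (ε : ℂ) • ψ) x‖ ^ 2 : ℝ) : ℂ) =
      ((2 - 2 * ε * (expect M ψ).re : ℝ) : ℂ) := by
    rw [← expect_one, e1, expect_mulVec, e2, expect_add, expect_smul, expect_smul, expect_one, hψ,
      expect_eq_ofReal hM ψ]
    push_cast
    simp
    ring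
  exact_mod_cast h

lemma abs_expect_le_one {M : Op V} (hM : Mᴴ = M) (hMM : M * M = 1) {ψ : Bits V → ℂ}
    (hψ : ∑ x, ‖ψ x‖ ^ 2 = 1) : |(expect M ψ).re| ≤ 1 := by
  have h1 := sum_norm_sq_mulVec_sub hM hMM hψ (ε := 1) (by norm_num)
  have h2 := sum_norm_sq_mulVec_sub hM hMM hψ (ε := -1) (by norm_num)
  have h3 : 0 ≤ ∑ x, ‖(M *ᵥ ψ - ((1 : ℝ) : ℂ) • ψ) x‖ ^ 2 := by positivity
  have h4 : 0 ≤ ∑ x, ‖(M *ᵥ ψ - ((-1 : ℝ) : ℂ) • ψ) x‖ ^ 2 := by positivity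
  rw [abs_le]
  constructor <;> linarith

lemma mulVec_eq_smul_of_expect {M : Op V} (hM : Mᴴ = M) (hMM : M * M = 1) {ψ : Bits V → ℂ}
    (hψ : ∑ x, ‖ψ x‖ ^ 2 = 1) {ε : ℝ} (hε : ε * ε = 1) (h : expect M ψ = ε) :
    M *ᵥ ψ = (ε : ℂ) • ψ := by
  have h1 := sum_norm_sq_mulVec_sub hM hMM hψ hε
  rw [h, Complex.ofReal_re, mul_assoc, hε] at h1
  norm_num at h1
  rw [Finset.sum_eq_zero_iff_of_nonneg (fun x _ => by positivity)] at h1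
  funext x
  have h2 := h1 x (Finset.mem_univ x)
  have h3 : (M *ᵥ ψ) x - (ε : ℂ) * ψ x = 0 := by simpa using h2
  simpa [sub_eq_zero] using h3

/-- Parseval's identity for the Pauli basis. -/
lemma sum_norm_expect_pauliString_sq {ψ : Bits V → ℂ} (hψ : ∑ x, ‖ψ x‖ ^ 2 = 1) :
    ∑ p : V → Fin 4, ‖expect (pauliString p) ψ‖ ^ 2 = 2 ^ Fintype.card V := by
  have hc : ∀ z : ℂ, z * star z = ((‖z‖ ^ 2 : ℝ) : ℂ) := fun z => by
    rw [Complex.star_def, Complex.mul_conj']; simp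
  have e1 : ∀ p : V → Fin 4, expect (pauliString p) ψ =
      ∑ z : Bits V × Bits V, star (ψ z.1) * ψ z.2 * pauliString p z.1 z.2 := by
    intro p
    simp only [expect, dotProduct, mulVec, Fintype.sum_prod_type, Finset.mul_sum, Pi.star_apply]
    exact Finset.sum_congr rfl fun x _ => Finset.sum_congr rfl fun y _ => by ring
  have e2 : ((∑ p : V → Fin 4, ‖expect (pauliString p) ψ‖ ^ 2 : ℝ) : ℂ) =
      ((2 ^ Fintype.card V : ℝ) : ℂ) := by
    calc ((∑ p : V → Fin 4, ‖expect (pauliString p) ψ‖ ^ 2 : ℝ) : ℂ)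
        = ∑ p : V → Fin 4, ∑ z : Bits V × Bits V, ∑ w : Bits V × Bits V,
            (star (ψ z.1) * ψ z.2 * star (star (ψ w.1) * ψ w.2)) *
              (pauliString p z.1 z.2 * star (pauliString p w.1 w.2)) := by
          rw [Complex.ofReal_sum]
          refine Finset.sum_congr rfl fun p _ => ?_
          rw [← hc, e1, star_sum, Finset.sum_mul_sum]
          refine Finset.sum_congr rfl fun z _ => Finset.sum_congr rfl fun w _ => ?_
          rw [star_mul' (star (ψ w.1) * ψ w.2)]
          ring
      _ = ∑ z : Bits V × Bits V, ∑ w : Bits V × Bits V,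
            (star (ψ z.1) * ψ z.2 * star (star (ψ w.1) * ψ w.2)) *
              ∑ p : V → Fin 4, pauliString p z.1 z.2 * star (pauliString p w.1 w.2) := by
          rw [Finset.sum_comm]
          refine Finset.sum_congr rfl fun z _ => ?_
          rw [Finset.sum_comm]
          exact Finset.sum_congr rfl fun w _ => (Finset.mul_sum ..).symm
      _ = ∑ z : Bits V × Bits V,
            (star (ψ z.1) * ψ z.2 * star (star (ψ z.1) * ψ z.2)) * 2 ^ Fintype.card V := by
          refine Finset.sum_congr rfl fun z _ => ?_
          rw [Finset.sum_eq_single z]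
          · rw [sum_pauliString_mul_conj, if_pos rfl, if_pos rfl]
          · rintro w - hw
            rw [sum_pauliString_mul_conj]
            split_ifs with h1 h2
            · exact absurd (Prod.ext h1 h2).symm hw
            · simp
            · simp
          · simp
      _ = (((∑ x, ‖ψ x‖ ^ 2) * (∑ y, ‖ψ y‖ ^ 2) * 2 ^ Fintype.card V : ℝ) : ℂ) := by
          rw [Finset.sum_mul_sum, Finset.sum_mul, Fintype.sum_prod_type, Complex.ofReal_sum]
          refine Finset.sum_congr rfl fun x _ => ?_
          rw [Finset.sum_mul, Complex.ofReal_sum]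
          refine Finset.sum_congr rfl fun y _ => ?_
          rw [hc, norm_mul, norm_star]
          push_cast
          ring
      _ = _ := by rw [hψ]; simp
  exact_mod_cast e2

lemma expect_pauliString_eq_ofReal (p : V → Fin 4) (ψ : Bits V → ℂ) :
    expect (pauliString p) ψ = ((expect (pauliString p) ψ).re : ℂ) :=
  expect_eq_ofReal (pauliString_conjTranspose p) ψ

/-- The Pauli group elements fixing a unit vector `ψ` correspond to the Pauli strings whose
expectation value in `ψ` is `1` or `-1`. -/
lemma ncard_stabilizer {ψ : Bits V → ℂ} (hψ : ∑ x, ‖ψ x‖ ^ 2 = 1) :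
    {P : Op V | IsPauli P ∧ P *ᵥ ψ = ψ}.ncard =
      {p : V → Fin 4 | expect (pauliString p) ψ = 1 ∨ expect (pauliString p) ψ = -1}.ncard := by
  have himage : {P : Op V | IsPauli P ∧ P *ᵥ ψ = ψ} =
      (fun p => expect (pauliString p) ψ • pauliString p) ''
        {p : V → Fin 4 | expect (pauliString p) ψ = 1 ∨ expect (pauliString p) ψ = -1} := by
    ext P
    constructor
    · rintro ⟨⟨k, p, rfl⟩, hP⟩
      change ((Complex.I ^ (k : ℕ)) • pauliString p) *ᵥ ψ = ψ at hP
      have h1 : Complex.I ^ (k : ℕ) * expect (pauliString p) ψ = 1 := by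
        have : expect ((Complex.I ^ (k : ℕ)) • pauliString p) ψ = expect 1 ψ := by
          rw [expect, hP, expect, one_mulVec]
        rwa [expect_smul, expect_one, hψ, Complex.ofReal_one] at this
      have hr := expect_pauliString_eq_ofReal p ψ
      have hw : expect (pauliString p) ψ = 1 ∨
          expect (pauliString p) ψ = -1 := by
        have h2 := congrArg norm h1
        rw [norm_mul, norm_pow, Complex.norm_I, one_pow, one_mul, norm_one, hr,
          Complex.norm_real, Real.norm_eq_abs] at h2
        rcases eq_or_eq_neg_of_abs_eq h2 with h | h
        · left; rw [hr, h]; simp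
        · right; rw [hr, h]; simp
      refine ⟨p, hw, ?_⟩
      have h3 : expect (pauliString p) ψ = Complex.I ^ (k : ℕ) := by
        rcases hw with h | h <;> rw [h] at h1 ⊢
        · rw [← h1, mul_one]
        · rw [← h1]; ring
      simp only [h3]
      rfl
    · rintro ⟨p, hp, rfl⟩
      refine ⟨?_, ?_⟩
      · rcases hp with hp | hp
        · exact ⟨0, p, by simp [hp]; rfl⟩
        · exact ⟨2, p, by simp [hp]; rfl⟩
      · have h1 : ∃ ε : ℝ, ε * ε = 1 ∧ expect (pauliString p) ψ = ε := by
          rcases hp with hp | hp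
          · exact ⟨1, by norm_num, by simp [hp]⟩
          · exact ⟨-1, by norm_num, by simp [hp]⟩
        obtain ⟨ε, hε, h⟩ := h1
        have hε' : (ε : ℂ) * ε = 1 := by exact_mod_cast hε
        change (expect (pauliString p) ψ • pauliString p) *ᵥ ψ = ψ
        rw [smul_mulVec, mulVec_eq_smul_of_expect (pauliString_conjTranspose p)
          (pauliString_sq p) hψ hε h, h, smul_smul, hε', one_smul]
  rw [himage, Set.InjOn.ncard_image]
  intro p hp q hq hpq
  by_contra hne
  have h1 := congrArg (fun M => (M * pauliString p).trace) hpq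
  simp only [Matrix.smul_mul, trace_smul, trace_pauliString_mul, if_neg (Ne.symm hne),
    if_true, smul_eq_mul] at h1
  rcases hp with hp | hp <;> simp [hp] at h1

/-- A unit vector is a stabilizer state exactly if all its Pauli expectation values are `0`, `1`
or `-1`: by Parseval's identity their squares sum to `2 ^ n`, and exactly `2 ^ n` of them have
modulus one. -/
lemma isPureStabilizer_iff {ψ : Bits V → ℂ} (hψ : ∑ x, ‖ψ x‖ ^ 2 = 1) :
    IsPureStabilizer ψ ↔ ∀ p : V → Fin 4, expect (pauliString p) ψ = 0 ∨
      expect (pauliString p) ψ = 1 ∨ expect (pauliString p) ψ = -1 := by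
  classical
  rw [IsPureStabilizer, and_iff_right hψ, ncard_stabilizer hψ, Set.ncard_eq_toFinset_card']
  set S : Finset (V → Fin 4) :=
    {p : V → Fin 4 | expect (pauliString p) ψ = 1 ∨ expect (pauliString p) ψ = -1}.toFinset
    with hS
  have hmem : ∀ p, p ∈ S ↔ expect (pauliString p) ψ = 1 ∨ expect (pauliString p) ψ = -1 := by
    intro p; simp [hS]
  have hsum : (S.card : ℝ) + ∑ p ∈ Sᶜ, ‖expect (pauliString p) ψ‖ ^ 2 =
      2 ^ Fintype.card V := by
    rw [← sum_norm_expect_pauliString_sq hψ, ← Finset.sum_add_sum_compl S]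
    congr 1
    rw [Finset.sum_congr rfl (g := fun _ => (1 : ℝ))]
    · simp
    · intro p hp
      rcases (hmem p).1 hp with h | h <;> simp [h]
  have hiff : S.card = 2 ^ Fintype.card V ↔
      ∑ p ∈ Sᶜ, ‖expect (pauliString p) ψ‖ ^ 2 = 0 := by
    constructor
    · intro h
      rw [h] at hsum
      push_cast at hsum
      linarith
    · intro h
      rw [h, add_zero] at hsum
      exact_mod_cast hsum
  rw [hiff, Finset.sum_eq_zero_iff_of_nonneg (fun p _ => by positivity)]
  refine forall_congr' fun p => ?_
  rw [Finset.mem_compl, hmem]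
  simp only [ne_eq, OfNat.ofNat_ne_zero, not_false_eq_true, pow_eq_zero_iff, norm_eq_zero]
  tauto

end Expect

/-! ### Pauli measurements of stabilizer states -/

section Sign
variable {V : Type}

/-- The diagonal of the Pauli operator `∏ i ∈ A, (-Z_i)`, whose sign at the bit string `x` is the
parity of the number of zeros of `x` in `A`. -/
def signDiag (A : Finset V) (x : Bits V) : ℝ := ∏ i ∈ A, if x i = 1 then 1 else -1

lemma signDiag_mul_self (A : Finset V) (x : Bits V) : signDiag A x * signDiag A x = 1 := by
  rw [signDiag, ← Finset.prod_mul_distrib]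
  exact Finset.prod_eq_one fun i _ => by split_ifs <;> norm_num

end Sign

section Project
variable {V : Type} [Fintype V] [DecidableEq V]

/-- The post-measurement states of a Pauli observable `Q` with expectation value zero in a
stabilizer state are stabilizer states. A Pauli string `P` anticommuting with `Q` has expectation
value `0` in them; a commuting one has expectation value `⟨P⟩ ± ⟨P Q⟩`, an integer of modulus at
most one. -/
lemma IsPureStabilizer.add_pauliString_mulVec {ψ : Bits V → ℂ} (hψ : IsPureStabilizer ψ)
    {q : V → Fin 4} (hq : expect (pauliString q) ψ = 0) {ε : ℝ} (hε : ε * ε = 1) :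
    IsPureStabilizer (((√2)⁻¹ : ℂ) • ((1 + (ε : ℂ) • pauliString q) *ᵥ ψ)) := by
  have hstab := (isPureStabilizer_iff hψ.1).1 hψ
  have hε' : (ε : ℂ) * ε = 1 := by exact_mod_cast hε
  set Q := pauliString q with hQ
  set χ := ((√2)⁻¹ : ℂ) • ((1 + (ε : ℂ) • Q) *ᵥ ψ) with hχ
  have hc : star ((√2 : ℂ)⁻¹) * (√2 : ℂ)⁻¹ = 1 / 2 := by
    have h2 : (√2 : ℂ) * √2 = 2 := by
      exact_mod_cast Real.mul_self_sqrt (by norm_num : (0 : ℝ) ≤ 2)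
    rw [star_inv₀, Complex.star_def, Complex.conj_ofReal, ← mul_inv, h2, one_div]
  have hA : (1 + (ε : ℂ) • Q)ᴴ = 1 + (ε : ℂ) • Q := by
    rw [conjTranspose_add, conjTranspose_smul, conjTranspose_one, pauliString_conjTranspose]
    simp [hQ]
  have hexp : ∀ M, expect M χ =
      1 / 2 * expect ((1 + (ε : ℂ) • Q) * M * (1 + (ε : ℂ) • Q)) ψ := by
    intro M
    rw [hχ, expect_smul_vec, hc, expect_mulVec, hA]
  have hQQ : Q * Q = 1 := pauliString_sq q
  have hone : expect 1 ψ = 1 := by rw [expect_one, hψ.1, Complex.ofReal_one]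
  have hcomm : ∀ P : Op V, P * Q = Q * P →
      expect P χ = expect P ψ + ε * expect (P * Q) ψ := by
    intro P hPQ
    have e : (1 + (ε : ℂ) • Q) * P * (1 + (ε : ℂ) • Q) =
        (2 : ℂ) • P + (2 * (ε : ℂ)) • (P * Q) := by
      have h1 : P * Q * Q = P := by rw [Matrix.mul_assoc, hQQ, Matrix.mul_one]
      have h2 : (2 : ℂ) • P = P + ((ε : ℂ) * ε) • P := by rw [hε']; module
      simp only [Matrix.add_mul, Matrix.mul_add, Matrix.one_mul, Matrix.mul_one, Matrix.smul_mul,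
        Matrix.mul_smul, ← hPQ, h1]
      rw [h2]
      module
    rw [hexp, e, expect_add, expect_smul, expect_smul]
    ring
  have hunit : ∑ x, ‖χ x‖ ^ 2 = 1 := by
    have h1 := hcomm 1 (by simp)
    rw [Matrix.one_mul, hone, hq, mul_zero, add_zero, expect_one] at h1
    exact_mod_cast h1
  rw [isPureStabilizer_iff hunit]
  intro p
  rcases pauliString_comm_or_anticomm p q with hpq | hpq
  · have hPQ : ∃ z : ℤ, expect (pauliString p * Q) ψ = z := by
      obtain ⟨r, c, hc1, hr⟩ := pauliString_mul p q
      have hherm : (pauliString p * Q)ᴴ = pauliString p * Q := by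
        rw [conjTranspose_mul, pauliString_conjTranspose, pauliString_conjTranspose, ← hQ]
        exact hpq.symm
      have hreal := expect_eq_ofReal hherm ψ
      rw [← hQ] at hr
      rw [hr, expect_smul] at hreal ⊢
      have hnorm : ‖c * expect (pauliString r) ψ‖ = 0 ∨ ‖c * expect (pauliString r) ψ‖ = 1 := by
        rw [norm_mul, hc1, one_mul]
        rcases hstab r with h | h | h <;> simp [h]
      rw [hreal, Complex.norm_real, Real.norm_eq_abs] at hnorm
      rw [hreal]
      rcases hnorm with h | h
      · exact ⟨0, by rw [abs_eq_zero.1 h]; simp⟩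
      · rcases eq_or_eq_neg_of_abs_eq h with h | h
        · exact ⟨1, by rw [h]; simp⟩
        · exact ⟨-1, by rw [h]; simp⟩
    obtain ⟨z, hz⟩ := hPQ
    obtain ⟨w, hw⟩ : ∃ w : ℤ, expect (pauliString p) ψ = w := by
      rcases hstab p with h | h | h
      · exact ⟨0, by simp [h]⟩
      · exact ⟨1, by simp [h]⟩
      · exact ⟨-1, by simp [h]⟩
    obtain ⟨s, hs⟩ : ∃ s : ℤ, ε = s := by
      rcases mul_self_eq_one_iff.1 hε with h | h
      · exact ⟨1, by simp [h]⟩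
      · exact ⟨-1, by simp [h]⟩
    have hval : expect (pauliString p) χ = ((w + s * z : ℤ) : ℂ) := by
      rw [hcomm _ hpq, hz, hw, hs]
      push_cast
      ring
    have hle := abs_expect_le_one (pauliString_conjTranspose p) (pauliString_sq p) hunit
    rw [hval, Complex.intCast_re] at hle
    have hle' : |w + s * z| ≤ 1 := by exact_mod_cast hle
    rw [hval]
    generalize w + s * z = k at hle'
    obtain ⟨h1, h2⟩ := abs_le.1 hle'
    interval_cases k <;> simp
  · left
    have e : (1 + (ε : ℂ) • Q) * pauliString p * (1 + (ε : ℂ) • Q) = 0 := by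
      rw [← hQ] at hpq
      have h1 : Q * pauliString p * Q = -pauliString p := by
        rw [Matrix.mul_assoc, hpq, Matrix.mul_neg, ← Matrix.mul_assoc, hQQ, Matrix.one_mul]
      have h2 : pauliString p = ((ε : ℂ) * ε) • pauliString p := by rw [hε', one_smul]
      simp only [Matrix.add_mul, Matrix.mul_add, Matrix.one_mul, Matrix.mul_one, Matrix.smul_mul,
        Matrix.mul_smul, h1, hpq]
      nth_rewrite 1 [h2]
      module
    rw [hexp, e]
    simp [expect]

lemma diagonal_signDiag (A : Finset V) :
    (diagonal fun x => (signDiag A x : ℂ)) =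
      (((-1 : ℝ) ^ A.card : ℝ) : ℂ) • pauliString fun v => if v ∈ A then 3 else 0 := by
  have hsite : ∀ (v : V) (a b : Fin 2),
      pauliMatrix (if v ∈ A then 3 else 0) a b =
        if a = b then (if v ∈ A then (if a = 1 then -1 else 1) else 1) else 0 := by
    intro v a b
    by_cases hv : v ∈ A <;> simp only [hv, if_true, if_false] <;> fin_cases a <;>
      fin_cases b <;> simp [pauliMatrix]
  ext x y
  rw [Matrix.smul_apply, pauliString, tensorOp]
  by_cases h : x = y
  · subst h
    simp only [hsite, diagonal_apply_eq, if_true]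
    rw [Finset.prod_ite_mem, Finset.univ_inter, smul_eq_mul, ← Finset.prod_const, signDiag]
    push_cast
    rw [← Finset.prod_mul_distrib]
    refine Finset.prod_congr rfl fun i _ => ?_
    split_ifs <;> simp
  · obtain ⟨v, hv⟩ := Function.ne_iff.1 h
    rw [diagonal_apply_ne _ h, Finset.prod_eq_zero (Finset.mem_univ v) (by simp [hsite, hv]),
      smul_zero]

/-- The expectation value of `∏ i ∈ A, (-Z_i)` in the state `ψ`. -/
noncomputable def signMean (A : Finset V) (ψ : Bits V → ℂ) : ℝ :=
  ∑ x, signDiag A x * ‖ψ x‖ ^ 2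

lemma expect_diagonal_signDiag (A : Finset V) (ψ : Bits V → ℂ) :
    expect (diagonal fun x => (signDiag A x : ℂ)) ψ = signMean A ψ := by
  simp only [expect, dotProduct, mulVec_diagonal, signMean, Complex.ofReal_sum, Pi.star_apply]
  refine Finset.sum_congr rfl fun x _ => ?_
  have h : star (ψ x) * ψ x = ((‖ψ x‖ ^ 2 : ℝ) : ℂ) := by
    rw [Complex.star_def, Complex.conj_mul']; simp
  rw [Complex.ofReal_mul, ← h]
  ring

lemma signMean_mem {ψ : Bits V → ℂ} (hψ : IsPureStabilizer ψ) (A : Finset V) :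
    signMean A ψ = 0 ∨ signMean A ψ = 1 ∨ signMean A ψ = -1 := by
  have h := expect_diagonal_signDiag A ψ
  rw [diagonal_signDiag, expect_smul] at h
  have h1 : (-1 : ℝ) ^ A.card = 1 ∨ (-1 : ℝ) ^ A.card = -1 := neg_one_pow_eq_or ℝ _
  have h2 := (isPureStabilizer_iff hψ.1).1 hψ fun v => if v ∈ A then 3 else 0
  have h3 : (signMean A ψ : ℂ) = 0 ∨ (signMean A ψ : ℂ) = 1 ∨ (signMean A ψ : ℂ) = -1 := by
    rw [← h]
    rcases h1 with h1 | h1 <;> rcases h2 with h2 | h2 | h2 <;> rw [h1, h2] <;> simp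
  rcases h3 with h3 | h3 | h3
  · left; exact_mod_cast h3
  · right; left; exact_mod_cast h3
  · right; right; exact_mod_cast h3

lemma signDiag_mul_of_signMean {ψ : Bits V → ℂ} (hψ : IsPureStabilizer ψ) {A : Finset V}
    {ε : ℝ} (hε : ε * ε = 1) (h : signMean A ψ = ε) (x : Bits V) :
    (signDiag A x : ℂ) * ψ x = ε * ψ x := by
  have h1 := mulVec_eq_smul_of_expect (M := diagonal fun x => (signDiag A x : ℂ)) (ψ := ψ)
    (by rw [diagonal_conjTranspose]; congr 1; funext y; simp)
    (by
      rw [diagonal_mul_diagonal, ← diagonal_one]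
      congr 1; funext y; exact_mod_cast signDiag_mul_self A y) hψ.1 hε
    (by rw [expect_diagonal_signDiag, h])
  have h2 := congrFun h1 x
  simpa [mulVec_diagonal] using h2

lemma IsPureStabilizer.signDiag_project {ψ : Bits V → ℂ} (hψ : IsPureStabilizer ψ)
    {A : Finset V} (h : signMean A ψ = 0) {ε : ℝ} (hε : ε * ε = 1) :
    IsPureStabilizer fun x => ((√2)⁻¹ : ℂ) * ((1 + ε * signDiag A x) * ψ x) := by
  have hsgn : (-1 : ℝ) ^ A.card * (-1 : ℝ) ^ A.card = 1 := by
    rw [← mul_pow]; norm_num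
  have h1 : expect (pauliString fun v => if v ∈ A then 3 else 0) ψ = 0 := by
    have h2 := expect_diagonal_signDiag A ψ
    rw [diagonal_signDiag, expect_smul, h, Complex.ofReal_zero] at h2
    refine (mul_eq_zero.1 h2).resolve_left ?_
    simp
  have h3 := hψ.add_pauliString_mulVec h1 (ε := ε * (-1 : ℝ) ^ A.card)
    (by linear_combination (ε * ε) * hsgn + hε)
  convert h3 using 1
  rw [Complex.ofReal_mul, ← smul_smul, ← diagonal_signDiag, add_mulVec, smul_mulVec, one_mulVec]
  funext x
  simp [mulVec_diagonal]
  ring_nf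

end Project

/-! ### Signed decompositions into stabilizer states -/

section Robust
variable {V : Type} [Fintype V] [DecidableEq V]

/-- `HasRobustness ρ r`: the operator `ρ`, of arbitrary trace, is a difference `x σ - y τ` of
nonnegative multiples of stabilizer states of total weight `x + y ≤ r`. -/
def HasRobustness (ρ : Op V) (r : ℝ) : Prop :=
  ∃ x y : ℝ, 0 ≤ x ∧ 0 ≤ y ∧ x + y ≤ r ∧ ∃ σ ∈ STAB V, ∃ τ ∈ STAB V, ρ = x • σ - y • τ

lemma convex_STAB : Convex ℝ (STAB V) := convex_convexHull ℝ _

lemma IsPureStabilizer.ketbra_mem {ψ : Bits V → ℂ} (hψ : IsPureStabilizer ψ) :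
    ketbra ψ ∈ STAB V := subset_convexHull ℝ _ ⟨ψ, hψ, rfl⟩

lemma trace_ketbra (ψ : Bits V → ℂ) : (ketbra ψ).trace = ((∑ x, ‖ψ x‖ ^ 2 : ℝ) : ℂ) := by
  rw [ketbra, trace_vecMulVec, dotProduct_comm, ← expect_one, expect, one_mulVec]

lemma STAB_induction {C : Set (Op V)} (hC : Convex ℝ C)
    (h : ∀ ψ : Bits V → ℂ, IsPureStabilizer ψ → ketbra ψ ∈ C) {σ : Op V} (hσ : σ ∈ STAB V) :
    σ ∈ C :=
  convexHull_min (by rintro ρ ⟨ψ, hψ, rfl⟩; exact h ψ hψ) hC hσ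

lemma trace_of_mem_STAB {σ : Op V} (hσ : σ ∈ STAB V) : σ.trace = 1 := by
  refine STAB_induction (C := {σ | σ.trace = 1}) ?_ ?_ hσ
  · intro a ha b hb s t _ _ hst
    rw [Set.mem_ofPred_eq] at ha hb ⊢
    rw [trace_add, trace_smul, trace_smul, ha, hb, ← add_smul, hst, one_smul]
  · intro ψ hψ
    rw [Set.mem_ofPred_eq, trace_ketbra, hψ.1, Complex.ofReal_one]

lemma exists_smul_add_smul {σ τ : Op V} (hσ : σ ∈ STAB V) (hτ : τ ∈ STAB V) {x y : ℝ}
    (hx : 0 ≤ x) (hy : 0 ≤ y) : ∃ ω ∈ STAB V, x • σ + y • τ = (x + y) • ω := by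
  rcases (add_nonneg hx hy).eq_or_lt with h | h
  · have hx0 : x = 0 := by linarith
    have hy0 : y = 0 := by linarith
    exact ⟨σ, hσ, by simp [hx0, hy0]⟩
  · refine ⟨(x / (x + y)) • σ + (y / (x + y)) • τ, convex_STAB hσ hτ (by positivity)
      (by positivity) (by field_simp), ?_⟩
    rw [smul_add, smul_smul, smul_smul, mul_div_cancel₀ _ h.ne', mul_div_cancel₀ _ h.ne']

lemma HasRobustness.mono {ρ : Op V} {r s : ℝ} (h : HasRobustness ρ r) (hrs : r ≤ s) :
    HasRobustness ρ s := by
  obtain ⟨x, y, hx, hy, hxy, h⟩ := h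
  exact ⟨x, y, hx, hy, hxy.trans hrs, h⟩

lemma HasRobustness.add {ρ ρ' : Op V} {r r' : ℝ} (h : HasRobustness ρ r)
    (h' : HasRobustness ρ' r') : HasRobustness (ρ + ρ') (r + r') := by
  obtain ⟨x, y, hx, hy, hxy, σ, hσ, τ, hτ, rfl⟩ := h
  obtain ⟨x', y', hx', hy', hxy', σ', hσ', τ', hτ', rfl⟩ := h'
  obtain ⟨σ'', hσ'', h1⟩ := exists_smul_add_smul hσ hσ' hx hx'
  obtain ⟨τ'', hτ'', h2⟩ := exists_smul_add_smul hτ hτ' hy hy'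
  refine ⟨x + x', y + y', by positivity, by positivity, by linarith, σ'', hσ'', τ'', hτ'', ?_⟩
  rw [← h1, ← h2]
  abel

lemma HasRobustness.smul {ρ : Op V} {r : ℝ} (h : HasRobustness ρ r) (c : ℝ) :
    HasRobustness (c • ρ) (|c| * r) := by
  obtain ⟨x, y, hx, hy, hxy, σ, hσ, τ, hτ, rfl⟩ := h
  rcases le_total 0 c with hc | hc
  · refine ⟨c * x, c * y, by positivity, by positivity, ?_, σ, hσ, τ, hτ, ?_⟩
    · rw [abs_of_nonneg hc, ← mul_add]; gcongr
    · rw [smul_sub, smul_smul, smul_smul]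
  · have hc' : 0 ≤ -c := by linarith
    refine ⟨-c * y, -c * x, by positivity, by positivity, ?_, τ, hτ, σ, hσ, ?_⟩
    · rw [abs_of_nonpos hc, ← mul_add, add_comm y]; gcongr
    · module

lemma HasRobustness.sub {ρ ρ' : Op V} {r r' : ℝ} (h : HasRobustness ρ r)
    (h' : HasRobustness ρ' r') : HasRobustness (ρ - ρ') (r + r') := by
  have h1 := h.add (h'.smul (-1))
  simpa [← sub_eq_add_neg] using h1

lemma hasRobustness_of_mem_STAB {σ : Op V} (hσ : σ ∈ STAB V) : HasRobustness σ 1 :=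
  ⟨1, 0, zero_le_one, le_rfl, by norm_num, σ, hσ, σ, hσ, by simp⟩

lemma convex_hasRobustness (r : ℝ) : Convex ℝ {ρ : Op V | HasRobustness ρ r} := by
  intro a ha b hb s t hs ht hst
  have h := (HasRobustness.smul ha s).add (HasRobustness.smul hb t)
  rwa [abs_of_nonneg hs, abs_of_nonneg ht, ← add_mul, hst, one_mul] at h

lemma RoM_nonneg (ρ : Op V) : 0 ≤ RoM ρ := by
  refine Real.sInf_nonneg ?_
  rintro r ⟨a, ha, -, -, -, -, -, rfl⟩
  positivity

lemma HasRobustness.exists_of_trace {ρ : Op V} {r : ℝ} (h : HasRobustness ρ r)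
    (htr : ρ.trace = 1) : ∃ a : ℝ, 0 ≤ a ∧ 2 * a + 1 ≤ r ∧ ∃ σ ∈ STAB V, ∃ τ ∈ STAB V,
      ρ = (a + 1) • σ - a • τ := by
  obtain ⟨x, y, hx, hy, hxy, σ, hσ, τ, hτ, rfl⟩ := h
  have h1 : x - y = 1 := by
    rw [trace_sub, trace_smul, trace_smul, trace_of_mem_STAB hσ, trace_of_mem_STAB hτ] at htr
    simp only [Complex.real_smul, mul_one] at htr
    exact_mod_cast htr
  exact ⟨y, hy, by linarith, σ, hσ, τ, hτ, by rw [← h1]; simp⟩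

lemma HasRobustness.RoM_le {ρ : Op V} {r : ℝ} (h : HasRobustness ρ r) (htr : ρ.trace = 1) :
    RoM ρ ≤ r := by
  obtain ⟨a, ha, har, σ, hσ, τ, hτ, h⟩ := h.exists_of_trace htr
  rw [RoM]
  refine (csInf_le ?_ ?_).trans har
  · refine ⟨0, ?_⟩
    rintro r ⟨a, ha, -, -, -, -, -, rfl⟩
    positivity
  · exact ⟨a, ha, σ, hσ, τ, hτ, h, rfl⟩

/-- The hypothesis that `ρ` has some decomposition cannot be dropped: otherwise `RoM ρ` is the
infimum of the empty set. -/
lemma hasRobustness_of_RoM_lt {ρ : Op V} {r s : ℝ} (hs : HasRobustness ρ s) (htr : ρ.trace = 1)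
    (hr : RoM ρ < r) : HasRobustness ρ r := by
  obtain ⟨a, ha, -, σ, hσ, τ, hτ, h⟩ := hs.exists_of_trace htr
  rw [RoM] at hr
  obtain ⟨_, ⟨a, ha, σ, hσ, τ, hτ, h, rfl⟩, hlt⟩ :=
    exists_lt_of_csInf_lt (by exact ⟨_, a, ha, σ, hσ, τ, hτ, h, rfl⟩) hr
  exact ⟨a + 1, a, by positivity, ha, by linarith, σ, hσ, τ, hτ, h⟩

lemma isPureStabilizer_plusKet : IsPureStabilizer (plusKet V) := by
  have hsq : ((√(2 ^ Fintype.card V))⁻¹ : ℝ) ^ 2 = (2 ^ Fintype.card V)⁻¹ := by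
    rw [inv_pow, Real.sq_sqrt (by positivity)]
  have hunit : ∑ x, ‖plusKet V x‖ ^ 2 = 1 := by
    simp only [plusKet, Complex.norm_real, Real.norm_eq_abs, sq_abs, hsq, Finset.sum_const,
      Finset.card_univ, Fintype.card_fun, Fintype.card_fin, nsmul_eq_mul]
    push_cast
    exact mul_inv_cancel₀ (by positivity)
  rw [isPureStabilizer_iff hunit]
  intro p
  have hsite : ∀ v, (2 : ℂ)⁻¹ * ∑ a, ∑ b, pauliMatrix (p v) a b = 0 ∨
      (2 : ℂ)⁻¹ * ∑ a, ∑ b, pauliMatrix (p v) a b = 1 := by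
    intro v
    generalize p v = k
    fin_cases k <;> simp [pauliMatrix, Fin.sum_univ_two] <;> norm_num
  have h1 : expect (pauliString p) (plusKet V) =
      ∏ v, (2 : ℂ)⁻¹ * ∑ a, ∑ b, pauliMatrix (p v) a b := by
    have h2 : ∑ x : Bits V, ∑ y : Bits V, pauliString p x y =
        ∏ v, ∑ a, ∑ b, pauliMatrix (p v) a b := by
      simp only [Finset.prod_univ_sum, Fintype.piFinset_univ, pauliString, tensorOp]
    have hsq' : ((((√(2 ^ Fintype.card V))⁻¹ : ℝ) : ℂ)) * (((√(2 ^ Fintype.card V))⁻¹ : ℝ) : ℂ) =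
        (2 ^ Fintype.card V)⁻¹ := by
      rw [← Complex.ofReal_mul, ← sq, hsq]
      push_cast
      rfl
    rw [Finset.prod_mul_distrib, ← h2, Finset.prod_const, Finset.card_univ, inv_pow, ← hsq']
    simp only [expect, dotProduct, mulVec, plusKet, Pi.star_apply, Complex.star_def,
      Complex.conj_ofReal, Finset.mul_sum]
    exact Finset.sum_congr rfl fun x _ => Finset.sum_congr rfl fun y _ => by ring
  have h3 : (∏ v, (2 : ℂ)⁻¹ * ∑ a, ∑ b, pauliMatrix (p v) a b) = 0 ∨
      (∏ v, (2 : ℂ)⁻¹ * ∑ a, ∑ b, pauliMatrix (p v) a b) = 1 :=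
    Finset.prod_induction (fun v => (2 : ℂ)⁻¹ * ∑ a, ∑ b, pauliMatrix (p v) a b)
      (fun z => z = 0 ∨ z = 1)
      (by rintro a b (rfl | rfl) (rfl | rfl) <;> simp) (Or.inr rfl) (fun v _ => hsite v)
  rw [h1]
  tauto

lemma hasRobustness_zero {r : ℝ} (hr : 0 ≤ r) : HasRobustness (0 : Op V) r :=
  ⟨0, 0, le_rfl, le_rfl, by linarith, _, isPureStabilizer_plusKet.ketbra_mem, _,
    isPureStabilizer_plusKet.ketbra_mem, by simp⟩

lemma HasRobustness.sum {ι : Type*} (s : Finset ι) {ρ : ι → Op V} {r : ι → ℝ}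
    (h : ∀ i ∈ s, HasRobustness (ρ i) (r i)) :
    HasRobustness (∑ i ∈ s, ρ i) (∑ i ∈ s, r i) := by
  classical
  induction s using Finset.induction_on with
  | empty => simpa using hasRobustness_zero le_rfl
  | insert a s ha ih =>
    rw [Finset.sum_insert ha, Finset.sum_insert ha]
    exact (h a (by simp)).add (ih fun i hi => h i (by simp [hi]))

end Robust

/-! ### The robustness cost of one multi-controlled-`Z` gate -/

section Diag
variable {V : Type}

/-- Conjugation of `ρ` by the real diagonal operator with diagonal `d`. -/
noncomputable def conjDiag (d : Bits V → ℝ) : Op V →ₗ[ℝ] Op V where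
  toFun ρ := Matrix.of fun x y => (d x * d y) • ρ x y
  map_add' ρ ρ' := by ext x y; simp
  map_smul' c ρ := by ext x y; simp; ring

lemma conjDiag_apply (d : Bits V → ℝ) (ρ : Op V) (x y : Bits V) :
    conjDiag d ρ x y = (d x * d y) • ρ x y := rfl

lemma conjDiag_mul (d d' : Bits V → ℝ) (ρ : Op V) :
    conjDiag (fun x => d x * d' x) ρ = conjDiag d (conjDiag d' ρ) := by
  ext x y
  simp only [conjDiag_apply, smul_smul]
  congr 1
  ring

lemma ketbra_apply (ψ : Bits V → ℂ) (x y : Bits V) : ketbra ψ x y = ψ x * star (ψ y) := rfl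

lemma ketbra_diag_mul (d : Bits V → ℝ) (ψ : Bits V → ℂ) :
    ketbra (fun x => (d x : ℂ) * ψ x) = conjDiag d (ketbra ψ) := by
  ext x y
  simp only [conjDiag_apply, ketbra_apply, star_mul', Complex.star_def, Complex.conj_ofReal,
    Complex.real_smul, Complex.ofReal_mul]
  ring

/-- The diagonal of the projector onto the bit strings that are `1` on all of `F`. -/
def onesDiag (F : Finset V) (x : Bits V) : ℝ := if ∀ i ∈ F, x i = 1 then 1 else 0

/-- The diagonal of the multi-controlled-`Z` gate on `F`, as a real function. -/
def czSign (F : Finset V) (x : Bits V) : ℝ := if ∀ i ∈ F, x i = 1 then -1 else 1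

lemma czDiag_eq (F : Finset V) (x : Bits V) : czDiag F x = (czSign F x : ℂ) := by
  rw [czDiag, czSign]; split_ifs <;> simp

lemma czSign_eq (F : Finset V) (x : Bits V) : czSign F x = 1 - 2 * onesDiag F x := by
  rw [czSign, onesDiag]; split_ifs <;> norm_num

lemma czSign_mul_self (F : Finset V) (x : Bits V) : czSign F x * czSign F x = 1 := by
  rw [czSign]; split_ifs <;> norm_num

lemma onesDiag_eq_prod (F : Finset V) (x : Bits V) :
    onesDiag F x = ∏ i ∈ F, if x i = 1 then 1 else 0 := by
  rw [onesDiag, Finset.prod_ite_zero, Finset.prod_const_one]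

/-- The projector onto the bit strings that are `1` on `F` is the average of the group of Pauli
operators generated by the `-Z_i`, `i ∈ F`. -/
lemma onesDiag_eq_sum (F : Finset V) (x : Bits V) :
    onesDiag F x = (2 ^ F.card : ℝ)⁻¹ * ∑ A ∈ F.powerset, signDiag A x := by
  simp only [signDiag]
  rw [← Finset.prod_one_add, onesDiag_eq_prod, ← inv_pow, ← Finset.prod_const,
    ← Finset.prod_mul_distrib]
  refine Finset.prod_congr rfl fun i _ => ?_
  split_ifs <;> norm_num

lemma signDiag_symmDiff [DecidableEq V] (A B : Finset V) (x : Bits V) :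
    signDiag (symmDiff A B) x = signDiag A x * signDiag B x := by
  have h1 := signDiag_mul_self (A ∩ B) x
  have hA : signDiag A x = signDiag (A \ B) x * signDiag (A ∩ B) x := by
    rw [signDiag, signDiag, signDiag, ← Finset.prod_union (Finset.disjoint_sdiff_inter A B),
      Finset.sdiff_union_inter]
  have hB : signDiag B x = signDiag (B \ A) x * signDiag (A ∩ B) x := by
    rw [Finset.inter_comm, signDiag, signDiag, signDiag,
      ← Finset.prod_union (Finset.disjoint_sdiff_inter B A), Finset.sdiff_union_inter]
  have hAB : signDiag (symmDiff A B) x = signDiag (A \ B) x * signDiag (B \ A) x := by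
    rw [symmDiff_def, Finset.sup_eq_union, signDiag, signDiag, signDiag,
      Finset.prod_union disjoint_sdiff_sdiff]
  rw [hA, hB, hAB]
  linear_combination (-(signDiag (A \ B) x * signDiag (B \ A) x)) * h1

end Diag

section Gate
variable {V : Type} [Fintype V] [DecidableEq V]

/-- The (unnormalized) state after a measurement of the qubits in `F` with outcome `1` everywhere
is a multiple of a stabilizer state. -/
lemma exists_conjDiag_onesDiag {ψ : Bits V → ℂ} (hψ : IsPureStabilizer ψ) (F : Finset V) :
    ∃ t : ℝ, 0 ≤ t ∧ ∃ χ : Bits V → ℂ, IsPureStabilizer χ ∧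
      conjDiag (onesDiag F) (ketbra ψ) = t • ketbra χ := by
  induction F using Finset.induction_on with
  | empty =>
    refine ⟨1, zero_le_one, ψ, hψ, ?_⟩
    ext x y
    simp [conjDiag_apply, onesDiag]
  | insert i F hi ih =>
    obtain ⟨t, ht, χ, hχ, h⟩ := ih
    have hsingle : ∃ t' : ℝ, 0 ≤ t' ∧ ∃ χ' : Bits V → ℂ, IsPureStabilizer χ' ∧
        conjDiag (onesDiag {i}) (ketbra χ) = t' • ketbra χ' := by
      have hone : ∀ x, onesDiag {i} x = (1 + signDiag {i} x) / 2 := by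
        intro x
        simp only [onesDiag, signDiag, Finset.mem_singleton, forall_eq, Finset.prod_singleton]
        split_ifs <;> norm_num
      rcases signMean_mem hχ {i} with h0 | h0 | h0
      · refine ⟨1 / 2, by norm_num, _, hχ.signDiag_project h0 (ε := 1) (by norm_num), ?_⟩
        have h2 : ((√2)⁻¹ : ℝ) * (√2)⁻¹ = 1 / 2 := by
          rw [← mul_inv, Real.mul_self_sqrt (by norm_num)]; norm_num
        have h3 : (fun x => ((√2 : ℂ))⁻¹ * ((1 + ((1 : ℝ) : ℂ) * signDiag {i} x) * χ x)) =
            fun x => (((√2)⁻¹ * (1 + signDiag {i} x) : ℝ) : ℂ) * χ x := by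
          funext x; push_cast; ring
        rw [h3, ketbra_diag_mul]
        ext x y
        rw [Matrix.smul_apply, conjDiag_apply, conjDiag_apply, smul_smul, hone, hone]
        congr 1
        linear_combination
          (-(1 / 2) * (1 + signDiag {i} x) * (1 + signDiag {i} y)) * h2
      · refine ⟨1, zero_le_one, χ, hχ, ?_⟩
        rw [one_smul, ← ketbra_diag_mul]
        congr 1
        funext x
        have h1 := signDiag_mul_of_signMean hχ (by norm_num) h0 x
        rw [hone]
        push_cast at h1 ⊢
        linear_combination h1 / 2
      · refine ⟨0, le_rfl, χ, hχ, ?_⟩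
        rw [zero_smul, ← ketbra_diag_mul]
        have h2 : (fun x => (onesDiag {i} x : ℂ) * χ x) = 0 := by
          funext x
          have h1 := signDiag_mul_of_signMean hχ (by norm_num) h0 x
          rw [hone, Pi.zero_apply]
          push_cast at h1 ⊢
          linear_combination h1 / 2
        rw [h2]
        ext x y
        simp [ketbra_apply]
    obtain ⟨t', ht', χ', hχ', h'⟩ := hsingle
    refine ⟨t * t', by positivity, χ', hχ', ?_⟩
    have hmul : onesDiag (insert i F) = fun x => onesDiag {i} x * onesDiag F x := by
      funext x
      rw [onesDiag_eq_prod, onesDiag_eq_prod, onesDiag_eq_prod, Finset.prod_insert hi,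
        Finset.prod_singleton]
    rw [hmul, conjDiag_mul, h, map_smul, h', smul_smul]

lemma hasRobustness_conjDiag_onesDiag {ψ : Bits V → ℂ} (hψ : IsPureStabilizer ψ)
    (F : Finset V) :
    HasRobustness (conjDiag (onesDiag F) (ketbra ψ)) (∑ x, onesDiag F x * ‖ψ x‖ ^ 2) := by
  obtain ⟨t, ht, χ, hχ, h⟩ := exists_conjDiag_onesDiag hψ F
  have htr := congrArg trace h
  rw [← ketbra_diag_mul, trace_ketbra, trace_smul, trace_ketbra, hχ.1, Complex.ofReal_one,
    Complex.real_smul, mul_one] at htr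
  have h1 : ∑ x, onesDiag F x * ‖ψ x‖ ^ 2 = t := by
    rw [← Complex.ofReal_inj, ← htr, Complex.ofReal_inj]
    refine Finset.sum_congr rfl fun x _ => ?_
    rw [norm_mul, mul_pow, Complex.norm_real, onesDiag]
    split_ifs <;> simp
  rw [h, h1]
  simpa [abs_of_nonneg ht] using (hasRobustness_of_mem_STAB hχ.ketbra_mem).smul t

/-- A multi-controlled-`Z` gate turns a pure stabilizer state `ψ` into a state of robustness at
most `5`. Write the gate as `1 - 2 P` with `P` the average of the Pauli operators `g`
generated by the `-Z_i`, and let `p` be the proportion of those with `g ψ = ψ`; unless the gate acts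
trivially, all others have expectation value `0`, and `p ≤ 1 / 2`. The anticommutator of such a `g`
with `|ψ⟩⟨ψ|` is the difference of the two post-measurement states of `g`, so expanding
`(1 - 2 P) |ψ⟩⟨ψ| (1 - 2 P)` gives total weight `|1 - 4 p| + 4 (1 - p) + 4 p ≤ 5`. -/
lemma IsPureStabilizer.hasRobustness_conjDiag_czSign {ψ : Bits V → ℂ} (hψ : IsPureStabilizer ψ)
    (F : Finset V) : HasRobustness (conjDiag (czSign F) (ketbra ψ)) 5 := by
  have htriv : conjDiag (czSign F) (ketbra ψ) = ketbra ψ →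
      HasRobustness (conjDiag (czSign F) (ketbra ψ)) 5 := by
    intro h
    rw [h]
    exact (hasRobustness_of_mem_STAB hψ.ketbra_mem).mono (by norm_num)
  by_cases hneg : ∃ A ∈ F.powerset, signMean A ψ = -1
  · -- `P ψ = 0`
    obtain ⟨A, hA, hm⟩ := hneg
    refine htriv ?_
    rw [← ketbra_diag_mul]
    congr 1
    funext x
    by_cases hx : ∀ i ∈ F, x i = 1
    · have h1 := signDiag_mul_of_signMean hψ (by norm_num) hm x
      have h2 : signDiag A x = 1 :=
        Finset.prod_eq_one fun i hi => if_pos (hx i (Finset.mem_powerset.1 hA hi))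
      rw [h2] at h1
      push_cast at h1
      have h3 : ψ x = 0 := by linear_combination h1 / 2
      simp [h3]
    · simp [czSign, hx]
  push Not at hneg
  set H := {A ∈ F.powerset | signMean A ψ = 1} with hH
  set N := {A ∈ F.powerset | ¬ signMean A ψ = 1} with hN
  have hfixed : ∀ A ∈ H, ∀ x, (signDiag A x : ℂ) * ψ x = ψ x := by
    intro A hA x
    have h1 := signDiag_mul_of_signMean hψ (ε := 1) (by norm_num) (Finset.mem_filter.1 hA).2 x
    simpa using h1
  have hzero : ∀ A ∈ N, signMean A ψ = 0 := by
    intro A hA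
    obtain ⟨h1, h2⟩ := Finset.mem_filter.1 hA
    rcases signMean_mem hψ A with h | h | h
    · exact h
    · exact absurd h h2
    · exact absurd h (hneg A h1)
  have hcard : (H.card : ℝ) + N.card = 2 ^ F.card := by
    have := Finset.card_filter_add_card_filter_not (s := F.powerset) fun A => signMean A ψ = 1
    rw [Finset.card_powerset] at this
    exact_mod_cast this
  have hpow : (0 : ℝ) < 2 ^ F.card := by positivity
  have hones : ∀ x, (onesDiag F x : ℂ) * ψ x = (2 ^ F.card : ℂ)⁻¹ *
      (H.card * ψ x + ∑ A ∈ N, signDiag A x * ψ x) := by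
    intro x
    rw [onesDiag_eq_sum, ← Finset.sum_filter_add_sum_filter_not F.powerset
      (fun A => signMean A ψ = 1)]
    push_cast
    rw [mul_assoc, add_mul, Finset.sum_mul, Finset.sum_mul,
      Finset.sum_congr rfl (fun A hA => hfixed A hA x)]
    simp [hN]
  rcases N.eq_empty_or_nonempty with hNe | ⟨A₀, hA₀⟩
  · -- `P ψ = ψ`
    refine htriv ?_
    have h1 : ketbra ψ = conjDiag (fun _ => -1) (ketbra ψ) := by
      ext x y; simp [conjDiag_apply]
    rw [← ketbra_diag_mul, h1, ← ketbra_diag_mul]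
    congr 1
    funext x
    have h2 := hones x
    rw [hNe, Finset.card_empty, Nat.cast_zero, add_zero] at hcard
    have hcard' : (H.card : ℂ) = 2 ^ F.card := by exact_mod_cast hcard
    rw [hNe, Finset.sum_empty, add_zero, hcard', inv_mul_cancel_left₀ (pow_ne_zero _ two_ne_zero)] at h2
    rw [czSign_eq]
    push_cast
    linear_combination -2 * h2
  have hle : (H.card : ℝ) ≤ N.card := by
    -- multiplication by an element outside the subgroup `H` maps it into the complement
    have : H.card ≤ N.card := by
      refine Finset.card_le_card_of_injOn (fun A => symmDiff A A₀) ?_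
        (fun A _ B _ h => symmDiff_left_injective _ h)
      intro A hA
      have hA' := Finset.mem_filter.1 hA
      have hA₀' := Finset.mem_filter.1 hA₀
      refine Finset.mem_filter.2 ⟨?_, ?_⟩
      · rw [Finset.mem_powerset] at *
        exact (Finset.symmDiff_subset_union).trans (Finset.union_subset hA'.1 hA₀'.1)
      · have : signMean (symmDiff A A₀) ψ = signMean A₀ ψ := by
          refine Finset.sum_congr rfl fun x _ => ?_
          by_cases hx : ψ x = 0
          · simp [hx]
          · have h1 := hfixed A hA x
            rw [mul_eq_right₀ hx] at h1
            rw [signDiag_symmDiff, show signDiag A x = 1 by exact_mod_cast h1, one_mul]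
        rw [this, hzero A₀ hA₀]
        norm_num
    exact_mod_cast this
  set post : Finset V → ℝ → Op V := fun A ε =>
    ketbra fun x => ((√2)⁻¹ : ℂ) * ((1 + ε * signDiag A x) * ψ x) with hpost
  have hpost_rob : ∀ A ∈ N, HasRobustness (post A 1 - post A (-1)) (1 + 1) := by
    intro A hA
    exact (hasRobustness_of_mem_STAB
      (hψ.signDiag_project (hzero A hA) (ε := 1) (by norm_num)).ketbra_mem).sub
      (hasRobustness_of_mem_STAB
        (hψ.signDiag_project (hzero A hA) (ε := -1) (by norm_num)).ketbra_mem)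
  have hpost_apply : ∀ A x y, (post A 1 - post A (-1)) x y =
      (signDiag A x + signDiag A y) * (ψ x * star (ψ y)) := by
    intro A x y
    have h2 : (√2 : ℂ)⁻¹ * (√2 : ℂ)⁻¹ = 1 / 2 := by
      rw [← mul_inv, ← Complex.ofReal_mul, Real.mul_self_sqrt (by norm_num)]; norm_num
    simp only [hpost, Matrix.sub_apply, ketbra_apply, star_mul', star_add, star_one, star_inv₀,
      Complex.star_def, Complex.conj_ofReal]
    push_cast
    linear_combination (2 * (signDiag A x + signDiag A y) * (ψ x * (starRingEnd ℂ) (ψ y))) * h2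
  set p : ℝ := H.card / 2 ^ F.card with hp
  have hdecomp : conjDiag (czSign F) (ketbra ψ) =
      (1 - 4 * p) • ketbra ψ + (-(2 / 2 ^ F.card) : ℝ) • ∑ A ∈ N, (post A 1 - post A (-1)) +
        (4 : ℝ) • conjDiag (onesDiag F) (ketbra ψ) := by
    ext x y
    have hx := hones x
    have hy := congrArg star (hones y)
    simp only [star_mul', star_add, star_sum, star_inv₀, star_pow, star_natCast, star_ofNat,
      Complex.star_def, Complex.conj_ofReal] at hy
    simp only [Matrix.add_apply, Matrix.smul_apply, Matrix.sum_apply, hpost_apply, conjDiag_apply,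
      ketbra_apply, czSign_eq, hp, Complex.real_smul, Complex.star_def]
    push_cast
    simp only [add_mul, Finset.sum_add_distrib]
    have e1 : ∑ A ∈ N, (signDiag A x : ℂ) * (ψ x * (starRingEnd ℂ) (ψ y)) =
        (∑ A ∈ N, signDiag A x * ψ x) * (starRingEnd ℂ) (ψ y) := by
      rw [Finset.sum_mul]; exact Finset.sum_congr rfl fun _ _ => by ring
    have e2 : ∑ A ∈ N, (signDiag A y : ℂ) * (ψ x * (starRingEnd ℂ) (ψ y)) =
        ψ x * ∑ A ∈ N, signDiag A y * (starRingEnd ℂ) (ψ y) := by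
      rw [Finset.mul_sum]; exact Finset.sum_congr rfl fun _ _ => by ring
    rw [e1, e2]
    linear_combination (-2 * (starRingEnd ℂ) (ψ y)) * hx + (-2 * ψ x) * hy
  have hpsum : ∑ x, onesDiag F x * ‖ψ x‖ ^ 2 = p := by
    simp only [onesDiag_eq_sum, Finset.mul_sum, Finset.sum_mul]
    rw [Finset.sum_comm]
    have e : ∀ A, ∑ x, (2 ^ F.card : ℝ)⁻¹ * signDiag A x * ‖ψ x‖ ^ 2 =
        (2 ^ F.card : ℝ)⁻¹ * signMean A ψ := by
      intro A
      rw [signMean, Finset.mul_sum]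
      exact Finset.sum_congr rfl fun _ _ => by ring
    simp only [e]
    rw [← Finset.mul_sum, ← Finset.sum_filter_add_sum_filter_not F.powerset
      (fun A => signMean A ψ = 1), Finset.sum_congr rfl (fun A hA => (Finset.mem_filter.1 hA).2),
      Finset.sum_eq_zero hzero, hp]
    simp [hH]
    ring
  have hrob := (((hasRobustness_of_mem_STAB hψ.ketbra_mem).smul (1 - 4 * p)).add
    ((HasRobustness.sum N hpost_rob).smul (-(2 / 2 ^ F.card)))).add
      ((hasRobustness_conjDiag_onesDiag hψ F).smul 4)
  rw [hdecomp]
  refine hrob.mono ?_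
  rw [hpsum, Finset.sum_const, nsmul_eq_mul, abs_neg,
    abs_of_nonneg (by positivity : (0 : ℝ) ≤ 2 / 2 ^ F.card),
    abs_of_nonneg (by norm_num : (0 : ℝ) ≤ 4)]
  have hp0 : 0 ≤ p := by positivity
  have hNp : (N.card : ℝ) / 2 ^ F.card = 1 - p := by
    rw [hp, eq_sub_iff_add_eq, ← add_div, add_comm, hcard, div_self hpow.ne']
  have hp1 : p ≤ 1 - p := by
    rw [← hNp, hp]; gcongr
  have habs : |1 - 4 * p| ≤ 1 := by rw [abs_le]; constructor <;> linarith
  have e : 2 / 2 ^ F.card * (N.card * (1 + 1)) = 4 * ((N.card : ℝ) / 2 ^ F.card) := by ring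
  rw [e, hNp]
  linarith

/-- Conjugation by a multi-controlled-`Z` gate increases robustness at most fivefold. -/
lemma HasRobustness.conjDiag_czSign {ρ : Op V} {r : ℝ} (h : HasRobustness ρ r) (F : Finset V) :
    HasRobustness (conjDiag (czSign F) ρ) (5 * r) := by
  have hstab : ∀ σ ∈ STAB V, HasRobustness (conjDiag (czSign F) σ) 5 := fun σ hσ =>
    STAB_induction (C := {σ | HasRobustness (conjDiag (czSign F) σ) 5})
      ((convex_hasRobustness 5).linear_preimage (conjDiag (czSign F)))
      (fun ψ hψ => hψ.hasRobustness_conjDiag_czSign F) hσ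
  obtain ⟨x, y, hx, hy, hxy, σ, hσ, τ, hτ, rfl⟩ := h
  rw [map_sub, map_smul, map_smul]
  refine (((hstab σ hσ).smul x).sub ((hstab τ hτ).smul y)).mono ?_
  rw [abs_of_nonneg hx, abs_of_nonneg hy]
  linarith

lemma HasRobustness.conjDiag_prod_czSign {ι : Type*} {ρ : Op V} {r : ℝ}
    (h : HasRobustness ρ r) (s : Finset ι) (F : ι → Finset V) :
    HasRobustness (conjDiag (fun x => ∏ j ∈ s, czSign (F j) x) ρ) (5 ^ s.card * r) := by
  classical
  induction s using Finset.induction_on with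
  | empty =>
    convert h using 1
    · ext x y; simp [conjDiag_apply]
    · simp
  | insert a s ha ih =>
    simp only [Finset.prod_insert ha]
    rw [conjDiag_mul, Finset.card_insert_of_notMem ha, pow_succ', mul_assoc]
    exact ih.conjDiag_czSign (F a)

end Gate

/-! ### Adding maximally mixed qubits -/

section Embed
variable {V : Type}

/-- The operator `(𝟙/2)^{⊗ I} ⊗ ρ`: the qubits in `I` are maximally mixed, the others are in the
state `ρ`. -/
noncomputable def embed (I : Finset V) : Op {i // i ∉ I} →ₗ[ℝ] Op V where
  toFun ρ := Matrix.of fun x y =>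
    if ∀ i : I, x i = y i then ((2 ^ I.card : ℝ)⁻¹) • ρ (fun i => x i) (fun i => y i) else 0
  map_add' ρ ρ' := by
    ext x y
    simp only [Matrix.of_apply, Matrix.add_apply]
    split_ifs <;> simp
  map_smul' c ρ := by
    ext x y
    simp only [Matrix.of_apply, Matrix.smul_apply, RingHom.id_apply]
    split_ifs
    · rw [smul_comm]
    · simp

lemma embed_apply (I : Finset V) (ρ : Op {i // i ∉ I}) (x y : Bits V) :
    embed I ρ x y =
      if ∀ i : I, x i = y i then ((2 ^ I.card : ℝ)⁻¹) • ρ (fun i => x i) (fun i => y i)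
      else 0 := rfl

end Embed

section Glue
variable {V : Type} [DecidableEq V]

/-- The bit string equal to `s` on `I` and to `x` outside `I`. -/
def glue (I : Finset V) (s : I → Fin 2) (x : Bits {i // i ∉ I}) : Bits V :=
  fun i => if h : i ∈ I then s ⟨i, h⟩ else x ⟨i, h⟩

lemma glue_mem {I : Finset V} (s : I → Fin 2) (x : Bits {i // i ∉ I}) (i : I) :
    glue I s x i = s i := by simp [glue]

lemma glue_notMem {I : Finset V} (s : I → Fin 2) (x : Bits {i // i ∉ I}) (i : {i // i ∉ I}) :
    glue I s x i = x i := by simp [glue, i.2]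

lemma glue_val (I : Finset V) (x : Bits V) :
    glue I (fun i => x i) (fun i => x i) = x := by
  funext i
  simp [glue]

lemma sum_bits_eq_sum_glue [Fintype V] {M : Type*} [AddCommMonoid M] (I : Finset V)
    (f : Bits V → M) : ∑ x, f x = ∑ s, ∑ x, f (glue I s x) := by
  rw [← Fintype.sum_prod_type']
  refine Fintype.sum_equiv (Equiv.piEquivPiSubtypeProd (fun i => i ∈ I) fun _ => Fin 2) _ _ ?_
  intro x
  exact congrArg f (glue_val I x).symm

/-- The product vector `|b⟩ ⊗ ψ` of a computational basis state of the qubits in `I` and a vector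
`ψ` of the others. -/
def basisTensor (I : Finset V) (b : I → Fin 2) (ψ : Bits {i // i ∉ I} → ℂ) : Bits V → ℂ :=
  fun x => if ∀ i : I, x i = b i then ψ fun i => x i else 0

lemma basisTensor_glue (I : Finset V) (b s : I → Fin 2) (ψ : Bits {i // i ∉ I} → ℂ)
    (x : Bits {i // i ∉ I}) : basisTensor I b ψ (glue I s x) = if s = b then ψ x else 0 := by
  simp only [basisTensor, glue_mem, glue_notMem, funext_iff]

variable [Fintype V]

lemma IsPureStabilizer.basisTensor {I : Finset V} {ψ : Bits {i // i ∉ I} → ℂ}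
    (hψ : IsPureStabilizer ψ) (b : I → Fin 2) : IsPureStabilizer (basisTensor I b ψ) := by
  have hunit : ∑ x, ‖HypergraphMagic.basisTensor I b ψ x‖ ^ 2 = 1 := by
    rw [sum_bits_eq_sum_glue I, Finset.sum_eq_single b]
    · simpa [basisTensor_glue] using hψ.1
    · intro s _ hs
      simp [basisTensor_glue, hs]
    · simp
  rw [isPureStabilizer_iff hunit]
  intro p
  have hstring : ∀ x y, pauliString p (glue I b x) (glue I b y) =
      (∏ i : I, pauliMatrix (p i) (b i) (b i)) * pauliString (fun i : {i // i ∉ I} => p i) x y := by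
    intro x y
    rw [pauliString, tensorOp, ← Fintype.prod_subtype_mul_prod_subtype (fun i => i ∈ I)]
    simp only [glue_notMem]
    congr 1
    exact Finset.prod_congr (by ext; simp) fun i _ => by rw [glue_mem b x i, glue_mem b y i]
  have h1 : expect (pauliString p) (HypergraphMagic.basisTensor I b ψ) =
      (∏ i : I, pauliMatrix (p i) (b i) (b i)) * expect (pauliString fun i : {i // i ∉ I} => p i) ψ := by
    simp only [expect, dotProduct, mulVec, Pi.star_apply]
    rw [sum_bits_eq_sum_glue I, Finset.sum_eq_single b, Finset.mul_sum]
    · refine Finset.sum_congr rfl fun x _ => ?_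
      rw [sum_bits_eq_sum_glue I, Finset.sum_eq_single b]
      · simp only [basisTensor_glue, if_true, hstring, Finset.mul_sum]
        exact Finset.sum_congr rfl fun y _ => by ring
      · intro s _ hs
        simp [basisTensor_glue, hs]
      · simp
    · intro s _ hs
      simp [basisTensor_glue, hs]
    · simp
  have h2 : (∏ i : I, pauliMatrix (p i) (b i) (b i)) = 0 ∨
      (∏ i : I, pauliMatrix (p i) (b i) (b i)) = 1 ∨
      (∏ i : I, pauliMatrix (p i) (b i) (b i)) = -1 := by
    refine Finset.prod_induction (fun i : I => pauliMatrix (p i) (b i) (b i))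
      (fun z => z = 0 ∨ z = 1 ∨ z = -1)
      (by rintro a b (rfl | rfl | rfl) (rfl | rfl | rfl) <;> simp) (Or.inr (Or.inl rfl)) ?_
    intro i _
    generalize p i = k
    generalize b i = c
    fin_cases k <;> fin_cases c <;> simp [pauliMatrix]
  rw [h1]
  rcases h2 with h2 | h2 | h2 <;>
    rcases (isPureStabilizer_iff hψ.1).1 hψ (fun i => p i) with h3 | h3 | h3 <;>
    rw [h2, h3] <;> simp

lemma embed_mem_STAB {I : Finset V} {σ : Op {i // i ∉ I}} (hσ : σ ∈ STAB {i // i ∉ I}) :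
    embed I σ ∈ STAB V := by
  refine STAB_induction (C := {σ | embed I σ ∈ STAB V})
    (convex_STAB.linear_preimage (embed I)) ?_ hσ
  intro ψ hψ
  -- the maximally mixed state is the uniform mixture of the computational basis states
  have h1 : embed I (ketbra ψ) =
      ∑ b : I → Fin 2, ((2 ^ I.card : ℝ)⁻¹) • ketbra (basisTensor I b ψ) := by
    ext x y
    rw [embed_apply, Matrix.sum_apply, Finset.sum_eq_single fun i : I => x i]
    · rw [Matrix.smul_apply, ketbra_apply, ketbra_apply, basisTensor, if_pos fun _ => rfl,
        basisTensor]
      by_cases h : ∀ i : I, x i = y i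
      · rw [if_pos h, if_pos fun i => (h i).symm]
      · rw [if_neg h, if_neg fun h' => h fun i => (h' i).symm]
        simp
    · intro b _ hb
      have hb' : ¬ ∀ i : I, x i = b i := fun h => hb (funext fun i => (h i).symm)
      rw [Matrix.smul_apply, ketbra_apply, basisTensor, if_neg hb', zero_mul, smul_zero]
    · simp
  rw [Set.mem_ofPred_eq, h1]
  refine convex_STAB.sum_mem (fun _ _ => by positivity) ?_
    fun b _ => (hψ.basisTensor b).ketbra_mem
  simp

lemma HasRobustness.embed {I : Finset V} {ρ : Op {i // i ∉ I}} {r : ℝ}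
    (h : HasRobustness ρ r) : HasRobustness (embed I ρ) r := by
  obtain ⟨x, y, hx, hy, hxy, σ, hσ, τ, hτ, rfl⟩ := h
  exact ⟨x, y, hx, hy, hxy, _, embed_mem_STAB hσ, _, embed_mem_STAB hτ, by
    rw [map_sub, map_smul, map_smul]⟩

end Glue

/-! ### Hypergraph states and their reductions -/

section Hyper
variable {V : Type} [Fintype V] [DecidableEq V]

/-- The sign of the basis state `x` in the hypergraph state with edge set `E`. -/
def edgeSign {V : Type} (E : Finset (Finset V)) (x : Bits V) : ℝ := ∏ e ∈ E, czSign e x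

lemma edgeSign_mul_self {V : Type} (E : Finset (Finset V)) (x : Bits V) :
    edgeSign E x * edgeSign E x = 1 := by
  rw [edgeSign, ← Finset.prod_mul_distrib]
  exact Finset.prod_eq_one fun e _ => czSign_mul_self e x

lemma hypergraphState_eq_conjDiag (E : Finset (Finset V)) :
    hypergraphState E = conjDiag (edgeSign E) (ketbra (plusKet V)) := by
  rw [← ketbra_diag_mul, hypergraphState]
  congr 1
  funext x
  rw [hypergraphKet, mulVec_diagonal, Finset.prod_apply, edgeSign]
  simp only [czDiag_eq]
  push_cast
  rfl

lemma hypergraphState_apply (E : Finset (Finset V)) (x y : Bits V) :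
    hypergraphState E x y =
      (((2 ^ Fintype.card V : ℝ)⁻¹ * (edgeSign E x * edgeSign E y) : ℝ) : ℂ) := by
  have h : ((√(2 ^ Fintype.card V))⁻¹ : ℝ) * (√(2 ^ Fintype.card V))⁻¹ =
      (2 ^ Fintype.card V)⁻¹ := by
    rw [← mul_inv, Real.mul_self_sqrt (by positivity)]
  rw [hypergraphState_eq_conjDiag, conjDiag_apply, ketbra_apply, plusKet, plusKet, Complex.star_def,
    Complex.conj_ofReal, ← Complex.ofReal_mul, h, Complex.real_smul, ← Complex.ofReal_mul,
    mul_comm]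

lemma trace_hypergraphState (E : Finset (Finset V)) : (hypergraphState E).trace = 1 := by
  simp only [Matrix.trace, Matrix.diag, hypergraphState_apply, edgeSign_mul_self, mul_one]
  simp

lemma hasRobustness_hypergraphState (E : Finset (Finset V)) :
    HasRobustness (hypergraphState E) (5 ^ E.card) := by
  rw [hypergraphState_eq_conjDiag]
  have h := (hasRobustness_of_mem_STAB
    (isPureStabilizer_plusKet (V := V)).ketbra_mem).conjDiag_prod_czSign E id
  rwa [mul_one] at h

lemma czSign_glue (e I : Finset V) (s : I → Fin 2) (x : Bits {i // i ∉ I}) :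
    czSign e (glue I s x) =
      if ∀ i : I, (i : V) ∈ e → s i = 1 then czSign (e.subtype fun i => i ∉ I) x else 1 := by
  have h : (∀ i ∈ e, glue I s x i = 1) ↔ (∀ i : I, (i : V) ∈ e → s i = 1) ∧
      ∀ i ∈ e.subtype (fun i => i ∉ I), x i = 1 := by
    constructor
    · intro h
      refine ⟨fun i hi => ?_, fun i hi => ?_⟩
      · rw [← glue_mem s x i]; exact h i hi
      · rw [← glue_notMem s x i]; exact h i (Finset.mem_subtype.1 hi)
    · rintro ⟨h1, h2⟩ i hi
      by_cases hI : i ∈ I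
      · exact (glue_mem s x ⟨i, hI⟩).trans (h1 ⟨i, hI⟩ hi)
      · exact (glue_notMem s x ⟨i, hI⟩).trans (h2 ⟨i, hI⟩ (Finset.mem_subtype.2 hi))
  rw [czSign, czSign]
  by_cases h1 : ∀ i : I, (i : V) ∈ e → s i = 1
  · rw [if_pos h1]
    by_cases h2 : ∀ i ∈ e.subtype (fun i => i ∉ I), x i = 1
    · rw [if_pos (h.2 ⟨h1, h2⟩), if_pos h2]
    · rw [if_neg fun h' => h2 (h.1 h').2, if_neg h2]
  · rw [if_neg h1, if_neg fun h' => h1 (h.1 h').1]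

/-- Fixing the qubits in `I` to `s` turns the signs of a hypergraph state into those of the reduced
hypergraph state: equal edges cancel in pairs. -/
lemma edgeSign_glue (E : Finset (Finset V)) (I : Finset V) (s : I → Fin 2)
    (x : Bits {i // i ∉ I}) :
    edgeSign E (glue I s x) = edgeSign (reducedEdges E I s) x := by
  have hpow : ∀ (F : Finset {i // i ∉ I}) (k : ℕ),
      czSign F x ^ k = if Odd k then czSign F x else 1 := by
    intro F k
    split_ifs with hk
    · obtain ⟨m, rfl⟩ := hk
      rw [pow_succ, pow_mul, sq, czSign_mul_self, one_pow, one_mul]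
    · obtain ⟨m, rfl⟩ := Nat.not_odd_iff_even.1 hk
      rw [← two_mul, pow_mul, sq, czSign_mul_self, one_pow]
  rw [edgeSign, edgeSign, reducedEdges, Finset.prod_filter]
  simp only [czSign_glue]
  rw [← Finset.prod_filter, ← Finset.prod_fiberwise _ (fun e => e.subtype fun i => i ∉ I)]
  refine Finset.prod_congr rfl fun F _ => ?_
  rw [Finset.filter_filter, ← hpow, ← Finset.prod_const]
  refine Finset.prod_congr rfl fun e he => ?_
  rw [(Finset.mem_filter.1 he).2.2]

lemma hypergraphState_glue (E : Finset (Finset V)) (I : Finset V) (s : I → Fin 2)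
    (x y : Bits {i // i ∉ I}) :
    hypergraphState E (glue I s x) (glue I s y) =
      (2 ^ I.card : ℝ)⁻¹ • hypergraphState (reducedEdges E I s) x y := by
  have hcard : Fintype.card V = I.card + Fintype.card {i // i ∉ I} := by
    rw [Fintype.card_subtype_compl, Fintype.card_coe]
    have := Finset.card_le_univ I
    omega
  rw [hypergraphState_apply, hypergraphState_apply, edgeSign_glue, edgeSign_glue,
    Complex.real_smul, ← Complex.ofReal_mul, hcard, pow_add, mul_inv, mul_assoc]

/-! ### The noisy hypergraph state as a mixture -/

lemma depolarize_single (lam : ℝ) (a b x y : Fin 2) :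
    depolarize lam (Matrix.single a b 1) x y =
      (if a = b ∧ x = y then (lam / 2 : ℂ) else 0) +
        if a = x ∧ b = y then (1 - lam : ℂ) else 0 := by
  rw [depolarize, Matrix.add_apply, Matrix.smul_apply, Matrix.smul_apply, Matrix.smul_apply,
    Matrix.smul_apply, Matrix.single_apply, Matrix.one_apply]
  by_cases hab : a = b
  · subst hab
    rw [Matrix.trace_single_eq_same]
    by_cases hxy : x = y <;> by_cases hax : a = x ∧ a = y <;> simp [hxy, hax] <;> ring
  · rw [Matrix.trace_single_eq_of_ne _ _ _ hab]
    simp [hab]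

lemma trace_depolarize_single (lam : ℝ) (a b : Fin 2) :
    (depolarize lam (Matrix.single a b 1)).trace = if a = b then 1 else 0 := by
  simp only [Matrix.trace, Matrix.diag, depolarize_single, Fin.sum_univ_two]
  fin_cases a <;> fin_cases b <;> simp <;> ring

lemma trace_noise (lam : ℝ) (ρ : Op V) : (noise lam ρ).trace = ρ.trace := by
  have hδ : ∀ a b : Bits V, (∀ v, a v = b v) ↔ a = b := fun a b => funext_iff.symm
  rw [noise, trace_sum]
  simp only [trace_sum, trace_smul, trace_tensorOp, trace_depolarize_single,
    Finset.prod_ite_zero, Finset.prod_const_one, Finset.mem_univ, forall_true_left, hδ,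
    smul_eq_mul, mul_ite, mul_one, mul_zero]
  simp [Matrix.trace]

lemma tensorOp_depolarize_single (lam : ℝ) (a b x y : Bits V) :
    tensorOp (fun v => depolarize lam (Matrix.single (a v) (b v) 1)) x y =
      ∑ I : Finset V, if (∀ i ∈ I, a i = b i ∧ x i = y i) ∧ ∀ i ∉ I, a i = x i ∧ b i = y i then
        (((1 - lam) ^ Iᶜ.card * (lam / 2) ^ I.card : ℝ) : ℂ) else 0 := by
  simp only [tensorOp, depolarize_single]
  rw [Finset.prod_add, Finset.powerset_univ]
  refine Finset.sum_congr rfl fun I _ => ?_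
  rw [Finset.prod_ite_zero, Finset.prod_ite_zero, Finset.prod_const, Finset.prod_const,
    ← Finset.compl_eq_univ_sdiff]
  simp only [Finset.mem_compl]
  by_cases h1 : ∀ i ∈ I, a i = b i ∧ x i = y i
  · by_cases h2 : ∀ i ∉ I, a i = x i ∧ b i = y i
    · rw [if_pos h1, if_pos h2, if_pos ⟨h1, h2⟩]
      push_cast
      ring
    · rw [if_neg h2, mul_zero, if_neg fun h => h2 h.2]
  · rw [if_neg h1, zero_mul, if_neg fun h => h1 h.1]

/-- Each qubit is depolarized independently with probability `lam`, and depolarizing a set `I` of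
qubits has the same effect as measuring them and then replacing them by maximally mixed ones. On a
hypergraph state the outcomes are uniformly distributed, and the outcome `s` leaves the reduced
hypergraph state on the other qubits. -/
lemma noise_hypergraphState (lam : ℝ) (E : Finset (Finset V)) :
    noise lam (hypergraphState E) = ∑ I : Finset V, ∑ s : I → Fin 2,
      ((1 - lam) ^ Iᶜ.card * (lam / 2) ^ I.card) •
        embed I (hypergraphState (reducedEdges E I s)) := by
  ext x y
  simp only [noise, Matrix.sum_apply, Matrix.smul_apply, tensorOp_depolarize_single, smul_eq_mul,
    Finset.mul_sum]
  rw [Finset.sum_congr rfl fun a _ => Finset.sum_comm, Finset.sum_comm]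
  refine Finset.sum_congr rfl fun I _ => ?_
  set w : ℝ := (1 - lam) ^ Iᶜ.card * (lam / 2) ^ I.card with hw
  rw [sum_bits_eq_sum_glue I]
  refine Finset.sum_congr rfl fun s _ => ?_
  have hcond : ∀ (t : I → Fin 2) (a b : Bits {i // i ∉ I}),
      ((∀ i ∈ I, glue I s a i = glue I t b i ∧ x i = y i) ∧
        ∀ i ∉ I, glue I s a i = x i ∧ glue I t b i = y i) ↔
      (∀ i : I, x i = y i) ∧ s = t ∧
        (a = fun i : {i // i ∉ I} => x i) ∧ b = fun i : {i // i ∉ I} => y i := by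
    intro t a b
    constructor
    · rintro ⟨h1, h2⟩
      refine ⟨fun i => (h1 i i.2).2, funext fun i => ?_, funext fun i => ?_, funext fun i => ?_⟩
      · simpa only [glue_mem] using (h1 i i.2).1
      · simpa only [glue_notMem] using (h2 i i.2).1
      · simpa only [glue_notMem] using (h2 i i.2).2
    · rintro ⟨h0, rfl, rfl, rfl⟩
      refine ⟨fun i hi => ⟨?_, h0 ⟨i, hi⟩⟩, fun i hi => ⟨?_, ?_⟩⟩
      · rw [glue_mem s _ ⟨i, hi⟩, glue_mem s _ ⟨i, hi⟩]
      · exact glue_notMem s _ ⟨i, hi⟩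
      · exact glue_notMem s _ ⟨i, hi⟩
  have hsum : ∀ a, ∑ b, hypergraphState E (glue I s a) b *
      (if (∀ i ∈ I, glue I s a i = b i ∧ x i = y i) ∧
        ∀ i ∉ I, glue I s a i = x i ∧ b i = y i then (w : ℂ) else 0) =
      if (∀ i : I, x i = y i) ∧ a = fun i : {i // i ∉ I} => x i then
        w • (2 ^ I.card : ℝ)⁻¹ • hypergraphState (reducedEdges E I s) a (fun i => y i)
      else 0 := by
    intro a
    rw [sum_bits_eq_sum_glue I]
    simp only [hcond]
    rw [Finset.sum_eq_single s, Finset.sum_eq_single fun i : {i // i ∉ I} => y i]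
    · rw [hypergraphState_glue]
      by_cases h : (∀ i : I, x i = y i) ∧ a = fun i : {i // i ∉ I} => x i
      · rw [if_pos h, if_pos ⟨h.1, rfl, h.2, rfl⟩, mul_comm, ← Complex.real_smul]
      · rw [if_neg h, if_neg fun h' => h ⟨h'.1, h'.2.2.1⟩, mul_zero]
    · intro b _ hb
      rw [if_neg fun h' => hb h'.2.2.2, mul_zero]
    · simp
    · intro t _ ht
      refine Finset.sum_eq_zero fun b _ => ?_
      rw [if_neg fun h' => ht h'.2.1.symm, mul_zero]
    · simp
  simp only [hsum]
  rw [Finset.sum_eq_single fun i : {i // i ∉ I} => x i, embed_apply]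
  · by_cases h : ∀ i : I, x i = y i
    · rw [if_pos ⟨h, rfl⟩, if_pos h]
    · rw [if_neg fun h' => h h'.1, if_neg h, smul_zero]
  · intro a _ ha
    rw [if_neg fun h => ha h.2]
  · simp

end Hyper

/-! ### The robustness of noisy hypergraph states with added edges -/

section Main
variable {V : Type} [Fintype V] [DecidableEq V]

/-- The probability that no qubit of `U` is depolarized with outcome `0`. -/
lemma sum_weight_eq (lam : ℝ) (U : Finset V) :
    ∑ I : Finset V, ∑ s : I → Fin 2, (if ∀ i : I, (i : V) ∈ U → s i = 1 then
      (1 - lam) ^ Iᶜ.card * (lam / 2) ^ I.card else 0) = (1 - lam / 2) ^ U.card := by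
  have h1 : ∀ I : Finset V, ∑ s : I → Fin 2, (if ∀ i : I, (i : V) ∈ U → s i = 1 then
      (1 - lam) ^ Iᶜ.card * (lam / 2) ^ I.card else 0) =
      (∏ i ∈ I, if i ∈ U then lam / 2 else lam) * ∏ i ∈ Finset.univ \ I, (1 - lam) := by
    intro I
    have h2 : ∑ s : I → Fin 2, (if ∀ i : I, (i : V) ∈ U → s i = 1 then
        (lam / 2) ^ I.card else 0) = ∏ i ∈ I, if i ∈ U then lam / 2 else lam := by
      have h3 : ∀ s : I → Fin 2, (if ∀ i : I, (i : V) ∈ U → s i = 1 then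
          (lam / 2) ^ I.card else 0) =
          ∏ i : I, if (i : V) ∈ U → s i = 1 then lam / 2 else 0 := by
        intro s
        rw [Finset.prod_ite_zero]
        simp [div_pow]
      have h4 := Finset.prod_univ_sum (fun _ : I => (Finset.univ : Finset (Fin 2)))
        (fun i b => if (i : V) ∈ U → b = 1 then lam / 2 else 0)
      rw [Fintype.piFinset_univ] at h4
      simp only [h3]
      rw [← h4, ← Finset.prod_coe_sort I]
      refine Finset.prod_congr rfl fun i _ => ?_
      rw [Fin.sum_univ_two]
      split_ifs <;> simp_all
    rw [← h2, ← Finset.compl_eq_univ_sdiff, Finset.prod_const, Finset.sum_mul]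
    refine Finset.sum_congr rfl fun s _ => ?_
    split_ifs <;> ring
  simp only [h1]
  rw [← Finset.powerset_univ, ← Finset.prod_add, ← Finset.prod_const,
    ← Finset.prod_subset (Finset.subset_univ U)]
  · refine Finset.prod_congr rfl fun i hi => ?_
    rw [if_pos hi]
    ring
  · intro i _ hi
    rw [if_neg hi]
    ring

lemma hypergraphState_reducedEdges_union {ι : Type*} (E : Finset (Finset V)) (S : Finset ι)
    (e : ι → Finset V) (hdisj : Disjoint E (S.image e)) (hinj : Set.InjOn e S) (I : Finset V)
    (s : I → Fin 2) :
    hypergraphState (reducedEdges (E ∪ S.image e) I s) =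
      conjDiag (fun x => ∏ j ∈ S with ∀ i : I, (i : V) ∈ e j → s i = 1,
        czSign ((e j).subtype fun i => i ∉ I) x) (hypergraphState (reducedEdges E I s)) := by
  rw [hypergraphState_eq_conjDiag, hypergraphState_eq_conjDiag, ← conjDiag_mul]
  congr 2
  funext x
  rw [← edgeSign_glue, ← edgeSign_glue, edgeSign, edgeSign, Finset.prod_union hdisj,
    Finset.prod_image hinj, mul_comm, Finset.prod_filter]
  simp only [czSign_glue]

lemma RoM_reducedEdges_le (E : Finset (Finset V)) (I : Finset V) (s : I → Fin 2) :
    RoM (hypergraphState (reducedEdges E I s)) ≤ maxReducedRoM E := by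
  unfold maxReducedRoM
  exact (Finset.le_sup'_iff _).2 ⟨⟨I, s⟩, Finset.mem_univ _, le_rfl⟩

lemma maxReducedRoM_nonneg (E : Finset (Finset V)) : 0 ≤ maxReducedRoM E :=
  (RoM_nonneg _).trans (RoM_reducedEdges_le E ∅ fun _ => 0)

lemma hasRobustness_of_maxReducedRoM_lt {E : Finset (Finset V)} {C : ℝ}
    (hC : maxReducedRoM E < C) (I : Finset V) (s : I → Fin 2) :
    HasRobustness (hypergraphState (reducedEdges E I s)) C :=
  hasRobustness_of_RoM_lt (hasRobustness_hypergraphState _) (trace_hypergraphState _)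
    ((RoM_reducedEdges_le E I s).trans_lt hC)

/-- After an outcome `s` on the qubits in `I`, adding the edges indexed by `S` changes the reduced
state only through the edges on whose qubits in `I` the outcome is `1`. -/
lemma hasRobustness_reduced_sub {ι : Type*} {E : Finset (Finset V)} {S : Finset ι}
    {e : ι → Finset V} (hdisj : Disjoint E (S.image e)) (hinj : Set.InjOn e S) {C : ℝ}
    {I : Finset V} {s : I → Fin 2}
    (hC : HasRobustness (hypergraphState (reducedEdges E I s)) C) :
    HasRobustness (hypergraphState (reducedEdges (E ∪ S.image e) I s) -
        hypergraphState (reducedEdges E I s))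
      (if {j ∈ S | ∀ i : I, (i : V) ∈ e j → s i = 1}.Nonempty then
        (5 ^ {j ∈ S | ∀ i : I, (i : V) ∈ e j → s i = 1}.card + 1) * C else 0) := by
  rw [hypergraphState_reducedEdges_union E S e hdisj hinj]
  split_ifs with h
  · rw [add_mul, one_mul]
    exact (hC.conjDiag_prod_czSign _ _).sub hC
  · rw [Finset.not_nonempty_iff_eq_empty.1 h]
    have h0 : conjDiag (fun x => ∏ j ∈ (∅ : Finset ι), czSign ((e j).subtype fun i => i ∉ I) x)
        (hypergraphState (reducedEdges E I s)) - hypergraphState (reducedEdges E I s) = 0 := by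
      ext x y
      simp [conjDiag_apply]
    rw [h0]
    exact hasRobustness_zero le_rfl

lemma sum_weight_mul_le {ι : Type*} [Fintype ι] [DecidableEq ι] {lam : ℝ} (hlam0 : 0 ≤ lam)
    (hlam1 : lam ≤ 1) (S : Finset ι) (e : ι → Finset V) {g : Finset ι → ℝ} (hg : ∀ J, 0 ≤ g J) :
    ∑ I : Finset V, ∑ s : I → Fin 2, (1 - lam) ^ Iᶜ.card * (lam / 2) ^ I.card *
        (if {j ∈ S | ∀ i : I, (i : V) ∈ e j → s i = 1}.Nonempty then
          g {j ∈ S | ∀ i : I, (i : V) ∈ e j → s i = 1} else 0) ≤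
      ∑ J : Finset ι with J.Nonempty, g J * (1 - lam / 2) ^ (J.biUnion e).card := by
  have h1 : 0 ≤ 1 - lam := by linarith
  have h2 : ∑ J : Finset ι with J.Nonempty, g J * (1 - lam / 2) ^ (J.biUnion e).card =
      ∑ I : Finset V, ∑ s : I → Fin 2, ∑ J : Finset ι with J.Nonempty, g J *
        (if ∀ i : I, (i : V) ∈ J.biUnion e → s i = 1 then
          (1 - lam) ^ Iᶜ.card * (lam / 2) ^ I.card else 0) := by
    simp only [← sum_weight_eq, Finset.mul_sum]
    rw [Finset.sum_comm]
    exact Finset.sum_congr rfl fun I _ => Finset.sum_comm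
  rw [h2]
  refine Finset.sum_le_sum fun I _ => Finset.sum_le_sum fun s _ => ?_
  have hnn : ∀ J ∈ ({J : Finset ι | J.Nonempty} : Finset (Finset ι)), 0 ≤ g J *
      (if ∀ i : I, (i : V) ∈ J.biUnion e → s i = 1 then
        (1 - lam) ^ Iᶜ.card * (lam / 2) ^ I.card else 0) := by
    intro J _
    refine mul_nonneg (hg J) ?_
    split_ifs <;> positivity
  split_ifs with hJ
  · refine le_trans (le_of_eq ?_)
      (Finset.single_le_sum hnn (Finset.mem_filter.2 ⟨Finset.mem_univ _, hJ⟩))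
    rw [if_pos, mul_comm]
    intro i hi
    obtain ⟨j, hj, hij⟩ := Finset.mem_biUnion.1 hi
    exact (Finset.mem_filter.1 hj).2 i hij
  · rw [mul_zero]
    exact Finset.sum_nonneg hnn

lemma hasRobustness_noise_union {ι : Type*} [Fintype ι] [DecidableEq ι] {lam : ℝ}
    (hlam0 : 0 ≤ lam) (hlam1 : lam ≤ 1) {E : Finset (Finset V)} {S : Finset ι}
    {e : ι → Finset V} (hdisj : Disjoint E (S.image e)) (hinj : Set.InjOn e S) {C r : ℝ}
    (hC : maxReducedRoM E < C) (hr : RoM (noise lam (hypergraphState E)) < r) :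
    HasRobustness (noise lam (hypergraphState (E ∪ S.image e)))
      (r + C * ∑ J : Finset ι with J.Nonempty,
        ((5 : ℝ) ^ J.card + 1) * (1 - lam / 2) ^ (J.biUnion e).card) := by
  have h1 : 0 ≤ 1 - lam := by linarith
  have hC0 : 0 ≤ C := (maxReducedRoM_nonneg E).trans hC.le
  have hred := hasRobustness_of_maxReducedRoM_lt hC
  have hΨ : HasRobustness (noise lam (hypergraphState E)) r := by
    refine hasRobustness_of_RoM_lt (s := ∑ I : Finset V, ∑ s : I → Fin 2,
      |(1 - lam) ^ Iᶜ.card * (lam / 2) ^ I.card| * C) ?_ ?_ hr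
    · rw [noise_hypergraphState]
      exact HasRobustness.sum _ fun I _ => HasRobustness.sum _ fun s _ =>
        (hred I s).embed.smul _
    · rw [trace_noise, trace_hypergraphState]
  have hdiff := HasRobustness.sum Finset.univ fun (I : Finset V) _ => HasRobustness.sum Finset.univ
    fun (s : I → Fin 2) _ => ((hasRobustness_reduced_sub hdisj hinj (hred I s)).embed.smul
      ((1 - lam) ^ Iᶜ.card * (lam / 2) ^ I.card))
  have hsum : noise lam (hypergraphState (E ∪ S.image e)) = noise lam (hypergraphState E) +
      ∑ I : Finset V, ∑ s : I → Fin 2, ((1 - lam) ^ Iᶜ.card * (lam / 2) ^ I.card) •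
        embed I (hypergraphState (reducedEdges (E ∪ S.image e) I s) -
          hypergraphState (reducedEdges E I s)) := by
    simp only [noise_hypergraphState, map_sub, smul_sub, Finset.sum_sub_distrib]
    abel
  rw [hsum]
  refine (hΨ.add hdiff).mono (add_le_add_right ?_ r)
  have hle := sum_weight_mul_le hlam0 hlam1 S e
    (g := fun J => ((5 : ℝ) ^ J.card + 1) * C) (fun J => by positivity)
  rw [Finset.mul_sum]
  refine le_trans (le_of_eq ?_) (hle.trans (le_of_eq ?_))
  · refine Finset.sum_congr rfl fun I _ => Finset.sum_congr rfl fun s _ => ?_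
    rw [abs_of_nonneg (by positivity)]
  · exact Finset.sum_congr rfl fun J _ => by ring

lemma RoM_noise_union_le {ι : Type*} [Fintype ι] [DecidableEq ι] {lam : ℝ}
    (hlam0 : 0 ≤ lam) (hlam1 : lam ≤ 1) (E : Finset (Finset V)) (e : ι → Finset V) :
    RoM (noise lam (hypergraphState (E ∪ Finset.univ.image e))) ≤
      RoM (noise lam (hypergraphState E)) + maxReducedRoM E *
        ∑ J : Finset ι with J.Nonempty,
          ((5 : ℝ) ^ J.card + 1) * (1 - lam / 2) ^ (J.biUnion e).card := by
  -- indices of pairwise distinct representatives of the edges that are not already in `E`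
  obtain ⟨S, hinj, himage⟩ : ∃ S : Finset ι, Set.InjOn e S ∧
      S.image e = Finset.univ.image e \ E := by
    obtain ⟨S, -, hinj, hS⟩ := Finset.exists_subset_injOn_image_eq_of_surjOn
      (f := e) Set.univ (Finset.univ.image e \ E) (by
        intro f hf
        obtain ⟨j, -, rfl⟩ := Finset.mem_image.1 (Finset.mem_sdiff.1 hf).1
        exact ⟨j, trivial, rfl⟩)
    exact ⟨S, hinj, hS⟩
  have hunion : E ∪ Finset.univ.image e = E ∪ S.image e := by
    rw [himage, Finset.union_sdiff_self_eq_union]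
  have hdisj : Disjoint E (S.image e) := by
    rw [himage]
    exact Finset.disjoint_sdiff
  set T := ∑ J : Finset ι with J.Nonempty,
    ((5 : ℝ) ^ J.card + 1) * (1 - lam / 2) ^ (J.biUnion e).card with hT
  have hT0 : 0 ≤ T := by
    have : 0 ≤ 1 - lam / 2 := by linarith
    exact Finset.sum_nonneg fun J _ => by positivity
  rw [hunion]
  -- the infimum defining `RoM` need not be known to be attained
  refine le_of_forall_pos_le_add fun ε hε => ?_
  have hδ : 0 < ε / (1 + T) := by positivity
  have h := (hasRobustness_noise_union hlam0 hlam1 hdisj hinj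
    (lt_add_of_pos_right (maxReducedRoM E) hδ)
    (lt_add_of_pos_right (RoM (noise lam (hypergraphState E))) hδ)).RoM_le
      (by rw [trace_noise, trace_hypergraphState])
  refine h.trans (le_of_eq ?_)
  rw [← hT]
  field_simp
  ring

end Main

lemma sum_pow_card_le {V : Type} [DecidableEq V] {K m : ℕ} {q : ℝ} (hq0 : 0 ≤ q) (hq1 : q ≤ 1) (e : Fin K → Finset V)
    (hm : ∀ j, m ≤ (e j).card) :
    ∑ J : Finset (Fin K) with J.Nonempty, ((5 : ℝ) ^ J.card + 1) * q ^ (J.biUnion e).card ≤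
      ((6 : ℝ) ^ K + 2 ^ K - 2) * q ^ m := by
  have h1 : ∑ J : Finset (Fin K) with J.Nonempty, ((5 : ℝ) ^ J.card + 1) =
      (6 : ℝ) ^ K + 2 ^ K - 2 := by
    have h5 : ∑ J : Finset (Fin K), ((5 : ℝ) ^ J.card + 1) = 6 ^ K + 2 ^ K := by
      have h6 := Fin.sum_pow_mul_eq_add_pow (n := K) (5 : ℝ) 1
      have h2 := Fin.sum_pow_mul_eq_add_pow (n := K) (1 : ℝ) 1
      simp only [one_pow, mul_one] at h6 h2
      rw [Finset.sum_add_distrib, h6, h2]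
      norm_num
    rw [← h5, ← Finset.sum_filter_add_sum_filter_not Finset.univ
      (fun J : Finset (Fin K) => J.Nonempty)]
    have he : ({J : Finset (Fin K) | ¬ J.Nonempty} : Finset (Finset (Fin K))) = {∅} := by
      ext J; simp
    rw [he]
    norm_num
  rw [← h1, Finset.sum_mul]
  refine Finset.sum_le_sum fun J hJ => ?_
  obtain ⟨j, hj⟩ := (Finset.mem_filter.1 hJ).2
  have hcard : m ≤ (J.biUnion e).card :=
    (hm j).trans (Finset.card_le_card (Finset.subset_biUnion_of_mem e hj))
  exact mul_le_mul_of_nonneg_left (pow_le_pow_of_le_one hq0 hq1 hcard) (by positivity)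

end HypergraphMagic

open HypergraphMagic

theorem mainTheorem2 (n K : ℕ) (E : Finset (Finset (Fin n))) (e : Fin K → Finset (Fin n))
    (lam : ℝ) (hlam0 : 0 ≤ lam) (hlam1 : lam ≤ 1) :
    RoM (noise lam (hypergraphState (E ∪ Finset.univ.image e))) ≤
        RoM (noise lam (hypergraphState E)) +
          maxReducedRoM E *
            ∑ J : Finset (Fin K) with J.Nonempty,
              ((5 : ℝ) ^ J.card + 1) * (1 - lam / 2) ^ (J.biUnion e).card ∧
      ∀ m : ℕ, (∀ j, m ≤ (e j).card) →
        RoM (noise lam (hypergraphState (E ∪ Finset.univ.image e))) ≤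
          RoM (noise lam (hypergraphState E)) +
            maxReducedRoM E * (((6 : ℝ) ^ K + 2 ^ K - 2) * (1 - lam / 2) ^ m) := by
  have h := RoM_noise_union_le hlam0 hlam1 E e
  refine ⟨h, fun m hm => h.trans (add_le_add_right ?_ _)⟩
  exact mul_le_mul_of_nonneg_left (sum_pow_card_le (by linarith) (by linarith) e hm)
    (maxReducedRoM_nonneg E)
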